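/- Graphs are finite, simple and undirected. A function $f:V\to\{0,1,2\}$ on the vertices of a graph $G=(V,E)$ is a \emph{perfect Roman dominating function} if every vertex $v$ with $f(v)=0$ has exactly one neighbor $w$ with $f(w)=2$; it is \emph{minimal} if no perfect Roman dominating function $g\neq f$ of $G$ satisfies $g(v)\le f(v)$ for all $v\in V$. \textbf{Theorem.} There is a single algorithm that, given an arbitrary graph $G$ of order $n$, outputs every minimal perfect Roman dominating function of $G$ exactly once, outputs nothing else, and then halts, such that \begin{itemize} \item its total running time is $\mathcal{O}^*(1.9332^n)$, i.e., at most $p(n)\cdot 1.9332^n$ for some polynomial $p$ that does not depend on $G$; \item it has polynomial delay, i.e., the time from the start to the first output, the time between any two subsequent outputs, and the time from the last output to the termination are each bounded by a polynomial in $n$; \item it uses polynomial space, i.e., its work memory consists, at every moment, of at most polynomially many (in $n$) registers holding numbers of at most polynomially many bits. \end{itemize} Here an algorithm is a program of a deterministic random access machine with addition, truncated subtraction, indirect addressing and an output instruction (which outputs the contents of a block of consecutive registers), started with empty work memory and with $n$ and the adjacency matrix of $G$ on a read-only input; time is the number of executed instructions. -/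

import Mathlib

/-! ### Perfect Roman dominating functions -/

/-- A Roman dominating function: every vertex of value `0` has a neighbour of value `2`. -/
def IsRomanDominating {V : Type*} (G : SimpleGraph V) (f : V → Fin 3) : Prop :=
  ∀ v, f v = 0 → ∃ w, G.Adj v w ∧ f w = 2

/-- A perfect Roman dominating function: a Roman dominating function for which every vertex of
value `0` has exactly one neighbour of value `2`. -/
def IsPerfectRomanDominating {V : Type*} (G : SimpleGraph V) (f : V → Fin 3) : Prop :=
  IsRomanDominating G f ∧ ∀ v, f v = 0 → ∃! w, G.Adj v w ∧ f w = 2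

/-- A minimal perfect Roman dominating function: minimal, for the pointwise order on functions
`V → {0, 1, 2}`, among the perfect Roman dominating functions. -/
def IsMinimalPerfectRomanDominating {V : Type*} (G : SimpleGraph V) (f : V → Fin 3) : Prop :=
  Minimal (IsPerfectRomanDominating G) f

/-! ### Random access machines with an output instruction

A machine has a read-only input word (a finite list of numbers) and a work memory of registers
`R[0], R[1], …`, each holding a natural number and all `0` at the start. Its program is a fixed
structured program whose expressions allow constants, addition, truncated subtraction and
(indirect) reading of the input and of the registers. -/

namespace RAM

/-- The contents of the registers. -/
abbrev Memory : Type := ℕ → ℕ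

/-- Arithmetic expressions. -/
inductive Expr : Type
  | const (k : ℕ) : Expr
  | input (a : Expr) : Expr
  | reg (a : Expr) : Expr
  | add (a b : Expr) : Expr
  | sub (a b : Expr) : Expr

/-- The value of an expression; reading behind the end of the input word gives `0`. -/
def Expr.eval (inp : List ℕ) (σ : Memory) : Expr → ℕ
  | .const k => k
  | .input a => inp.getD (a.eval inp σ) 0
  | .reg a => σ (a.eval inp σ)
  | .add a b => a.eval inp σ + b.eval inp σ
  | .sub a b => a.eval inp σ - b.eval inp σ

/-- Programs. `store a e` is the assignment `R[a] := e`; `output a l` outputs, as one word, the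
contents of the `l` consecutive registers from `R[a]` on; `cond e c d` executes `c` if `e ≠ 0` and
`d` if `e = 0`; `loop e c` repeats `c` as long as `e ≠ 0`. -/
inductive Program : Type
  | skip : Program
  | store (a e : Expr) : Program
  | output (a l : Expr) : Program
  | seq (c d : Program) : Program
  | cond (e : Expr) (c d : Program) : Program
  | loop (e : Expr) (c : Program) : Program

/-- A configuration: the programs that remain to be executed, in this order, and the memory. -/
structure Config : Type where
  todo : List Program
  mem : Memory

/-- One computation step: one assignment, one output, one test, or one piece of control flow. A
configuration in which nothing remains to be executed is halted. -/
def step (inp : List ℕ) : Config → Config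
  | ⟨[], σ⟩ => ⟨[], σ⟩
  | ⟨.skip :: K, σ⟩ => ⟨K, σ⟩
  | ⟨.store a e :: K, σ⟩ => ⟨K, Function.update σ (a.eval inp σ) (e.eval inp σ)⟩
  | ⟨.output _ _ :: K, σ⟩ => ⟨K, σ⟩
  | ⟨.seq c d :: K, σ⟩ => ⟨c :: d :: K, σ⟩
  | ⟨.cond e c d :: K, σ⟩ => if e.eval inp σ ≠ 0 then ⟨c :: K, σ⟩ else ⟨d :: K, σ⟩
  | ⟨.loop e c :: K, σ⟩ => if e.eval inp σ ≠ 0 then ⟨c :: .loop e c :: K, σ⟩ else ⟨K, σ⟩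

/-- The word that is output, if any, in the step that leads out of a configuration. -/
def emitted (inp : List ℕ) : Config → Option (List ℕ)
  | ⟨.output a l :: _, σ⟩ =>
      some ((List.range (l.eval inp σ)).map fun i => σ (a.eval inp σ + i))
  | _ => none

/-- The configuration of `P` on the input `inp` after `i` steps. -/
def run (P : Program) (inp : List ℕ) (i : ℕ) : Config :=
  (step inp)^[i] ⟨[P], fun _ => 0⟩

/-- `P` halts on `inp` after exactly `T` steps. -/
def HaltsAt (P : Program) (inp : List ℕ) (T : ℕ) : Prop :=
  (run P inp T).todo = [] ∧ ∀ i < T, (run P inp i).todo ≠ []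

/-- The words that `P` outputs on `inp` during the first `T` steps, in order of output. -/
def outputs (P : Program) (inp : List ℕ) (T : ℕ) : List (List ℕ) :=
  (List.range T).filterMap fun i => emitted inp (run P inp i)

/-- The points in time (numbers of steps from the start) at which `P` completes an output on `inp`
during the first `T` steps, in increasing order. -/
def outputTimes (P : Program) (inp : List ℕ) (T : ℕ) : List ℕ :=
  ((List.range T).filter fun i => (emitted inp (run P inp i)).isSome).map (· + 1)

/-- The delay of a run of length `T` is at most `d`: so many steps pass at most from the start to
the first output, between two subsequent outputs, and from the last output to the end. -/
def DelayAtMost (P : Program) (inp : List ℕ) (T d : ℕ) : Prop :=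
  List.IsChain (fun a b => b ≤ a + d) (0 :: (outputTimes P inp T ++ [T]))

/-- Throughout a run of length `T`, only the first `s` registers are in use, and each of them
holds a number of at most `s` bits; hence the memory holds at most `s * s` bits. -/
def SpaceAtMost (P : Program) (inp : List ℕ) (T s : ℕ) : Prop :=
  ∀ i ≤ T, ∀ a, (run P inp i).mem a ≠ 0 → a < s ∧ (run P inp i).mem a < 2 ^ s

/-- On the input `inp`, the program `P` outputs every element of `S` exactly once and nothing else,
and then halts, after `T` steps, with delay at most `d` and within space `s`. -/
structure Enumerates (P : Program) (inp : List ℕ) (S : Set (List ℕ)) (T d s : ℕ) : Prop where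
  halts : HaltsAt P inp T
  nodup : (outputs P inp T).Nodup
  mem_iff : ∀ w, w ∈ outputs P inp T ↔ w ∈ S
  delay : DelayAtMost P inp T d
  space : SpaceAtMost P inp T s

end RAM

/-- The input word of a graph of order `n`: the number `n`, followed by the rows of the adjacency
matrix (entry `(i, j)` stands at position `1 + i * n + j`). -/
def graphWord {n : ℕ} (G : SimpleGraph (Fin n)) [DecidableRel G.Adj] : List ℕ :=
  n :: List.ofFn fun k : Fin (n * n) => if G.Adj k.divNat k.modNat then 1 else 0

/-- A function `f : {0, …, n - 1} → {0, 1, 2}` as the word `f(0) f(1) … f(n - 1)`. -/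
def functionWord {n : ℕ} (f : Fin n → Fin 3) : List ℕ :=
  List.ofFn fun v => (f v : ℕ)

/-! A minimal perfect Roman dominating function is determined by its set `A` of vertices of value 2:
it is `romanOf G A`, which has value 0 wherever perfection allows it. This function is minimal
precisely if every member of `A` has a private neighbour outside `A` (`isMinimal_iff`), since a 2
without one could be lowered. The property passes to subsets, so the sets form a tree all of whose
nodes are solutions: a depth-first search adds vertices in increasing order, gives up a branch at
the first failure and outputs every node. At most polynomially many failures and backtracks lie
between two outputs, because the depth and the number of trials per level are at most `n`. The total
time is therefore a polynomial times the number of sets.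

It remains to show that there are at most `1.9332 ^ n` sets (`count_univ_le`). The count is
generalized to subsets of `U` with private neighbours in `C`. At `v ∈ U`, either `v` is discarded
and leaves `U`, or it is taken; then its closed neighbourhood leaves `C`, because no private
neighbour of another member is adjacent to `v` (`countIn_le`). One may also guess a private
neighbour `p` of `v`, and then the closed neighbourhood of `p` leaves `U` (`countIn_le_sum`).
Progress is measured by a product of vertex weights: 1.9332 for a vertex with both roles and a
neighbour in `U`, 1.7755 for the other vertices of `U`, and `xw` for those of `C \ U`. The weights
are tuned so that in every case the factors of the branches add up to at most 1; `count_le_weight`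
is then an induction.

The program needs no stack. The vector that it outputs also stores the search state: its entries 2
mark `A`, and the vertex added last is the largest one marked. `Exec` describes silent program
pieces, `Reach` runs with outputs and their delay; `reach_search` follows the search tree. -/

/-! ### Sets all of whose members have a private neighbour -/

namespace PrivateNeighbors

open Finset

variable {V : Type*} [Fintype V] [DecidableEq V] (G : SimpleGraph V) [DecidableRel G.Adj]

/-- Every member `a` of `A` has a neighbour in `C`, outside of `A`, whose only neighbour in `A`
is `a`. -/
def HasPrivate (C A : Finset V) : Prop :=
  ∀ a ∈ A, ∃ p ∈ C, p ∉ A ∧ G.Adj a p ∧ ∀ b ∈ A, G.Adj b p → b = a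

instance (C : Finset V) : DecidablePred (HasPrivate G C) := fun A => by
  unfold HasPrivate; infer_instance

variable {G} in
omit [Fintype V] [DecidableEq V] [DecidableRel G.Adj] in
-- This heredity makes every prefix of a solution a solution, so that the search may be pruned at a
-- failure.
theorem HasPrivate.subset {C A B : Finset V} (h : HasPrivate G C A) (hBA : B ⊆ A) :
    HasPrivate G C B := fun a ha => by
  obtain ⟨p, hp, hpA, hap, hu⟩ := h a (hBA ha)
  exact ⟨p, hp, fun hpB => hpA (hBA hpB), hap, fun b hb => hu b (hBA hb)⟩

/-- The number of subsets of `U` all of whose members have a private neighbour in `C`. -/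
def count (U C : Finset V) : ℕ := #{A ∈ U.powerset | HasPrivate G C A}

/-- The number of those subsets that contain `v`. -/
def countIn (v : V) (U C : Finset V) : ℕ := #{A ∈ U.powerset | v ∈ A ∧ HasPrivate G C A}

theorem count_le_add (v : V) (U C : Finset V) :
    count G U C ≤ count G (U.erase v) C + countIn G v U C := by
  unfold count countIn
  refine (card_le_card ?_).trans (card_union_le _ _)
  intro A hA
  simp only [mem_filter, mem_powerset, mem_union] at hA ⊢
  by_cases hv : v ∈ A
  · exact Or.inr ⟨hA.1, hv, hA.2⟩
  · exact Or.inl ⟨subset_erase.2 ⟨hA.1, hv⟩, hA.2⟩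

/-- A private neighbour of a member other than `v` is not adjacent to `v`, and is not `v` itself
because it lies outside `A`. Erasing `v` is injective on the sets that contain it. -/
theorem countIn_le (v : V) (U C : Finset V) :
    countIn G v U C ≤ count G (U.erase v) (C \ insert v (G.neighborFinset v)) := by
  unfold count countIn
  refine card_le_card_of_injOn (fun A => A.erase v) ?_ ?_
  · intro A hA
    simp only [coe_filter, mem_powerset, Set.mem_ofPred_eq] at hA ⊢
    refine ⟨erase_subset_erase v hA.1, fun a ha => ?_⟩
    obtain ⟨hav, ha⟩ := mem_erase.1 ha
    obtain ⟨p, hp, hpA, hap, hu⟩ := hA.2.2 a ha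
    refine ⟨p, ?_, fun h => hpA (mem_of_mem_erase h), hap,
      fun b hb => hu b (mem_of_mem_erase hb)⟩
    simp only [mem_sdiff, mem_insert, SimpleGraph.mem_neighborFinset, not_or]
    exact ⟨hp, fun h => hpA (h ▸ hA.2.1), fun h => hav (hu v hA.2.1 h).symm⟩
  · intro A hA B hB h
    simp only [coe_filter, mem_powerset, Set.mem_ofPred_eq] at hA hB
    have := congrArg (insert v) h
    simpa [insert_erase hA.2.1, insert_erase hB.2.1] using this

/-- If `p` is private for `v`, no other member equals or neighbours `p`. A set in which `v` has
several private neighbours is counted several times, which is harmless for an upper bound. -/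
theorem countIn_le_sum (v : V) (U C : Finset V) :
    countIn G v U C ≤ ∑ p ∈ C ∩ G.neighborFinset v,
      count G (U \ insert p (G.neighborFinset p)) (C \ insert v (G.neighborFinset v)) := by
  have hsub : ({A ∈ U.powerset | v ∈ A ∧ HasPrivate G C A} : Finset (Finset V)) ⊆
      (C ∩ G.neighborFinset v).biUnion fun p =>
        {A ∈ U.powerset | v ∈ A ∧ HasPrivate G C A ∧ p ∉ A ∧ ∀ b ∈ A, G.Adj b p → b = v} := by
    intro A hA
    simp only [mem_filter, mem_powerset, mem_biUnion, mem_inter,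
      SimpleGraph.mem_neighborFinset] at hA ⊢
    obtain ⟨p, hp, hpA, hap, hu⟩ := hA.2.2 v hA.2.1
    exact ⟨p, ⟨hp, hap⟩, hA.1, hA.2.1, hA.2.2, hpA, hu⟩
  refine ((card_le_card hsub).trans card_biUnion_le).trans (sum_le_sum fun p hp => ?_)
  refine card_le_card_of_injOn (fun A => A.erase v) ?_ ?_
  · intro A hA
    simp only [coe_filter, mem_powerset, Set.mem_ofPred_eq] at hA ⊢
    refine ⟨fun a ha => ?_, fun a ha => ?_⟩
    · obtain ⟨hav, ha⟩ := mem_erase.1 ha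
      simp only [mem_sdiff, mem_insert, SimpleGraph.mem_neighborFinset, not_or]
      exact ⟨hA.1 ha, fun h => hA.2.2.2.1 (h ▸ ha), fun h => hav (hA.2.2.2.2 a ha h.symm)⟩
    · obtain ⟨hav, ha⟩ := mem_erase.1 ha
      obtain ⟨q, hq, hqA, haq, hu⟩ := hA.2.2.1 a ha
      refine ⟨q, ?_, fun h => hqA (mem_of_mem_erase h), haq,
        fun b hb => hu b (mem_of_mem_erase hb)⟩
      simp only [mem_sdiff, mem_insert, SimpleGraph.mem_neighborFinset, not_or]
      exact ⟨hq, fun h => hqA (h ▸ hA.2.1), fun h => hav (hu v hA.2.1 h).symm⟩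
  · intro A hA B hB h
    simp only [coe_filter, mem_powerset, Set.mem_ofPred_eq] at hA hB
    have := congrArg (insert v) h
    simpa [insert_erase hA.2.1, insert_erase hB.2.1] using this

theorem count_le_erase_right {p : V} {U : Finset V} (C : Finset V)
    (h : G.neighborFinset p ∩ U = ∅) : count G U C ≤ count G U (C.erase p) := by
  refine card_le_card fun A hA => ?_
  simp only [mem_filter, mem_powerset] at hA ⊢
  refine ⟨hA.1, fun a ha => ?_⟩
  obtain ⟨q, hq, hqA, haq, hu⟩ := hA.2 a ha
  refine ⟨q, mem_erase.2 ⟨?_, hq⟩, hqA, haq, hu⟩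
  rintro rfl
  have : a ∈ G.neighborFinset q ∩ U := by simp [haq.symm, hA.1 ha]
  simp [h] at this

/-! ### The weight of a pair of vertex sets -/

/-- The weight of a vertex of `C \ U` with `m` neighbours in `U`. -/
noncomputable def xw : ℕ → ℝ
  | 0 => 1
  | 1 => 1.13
  | 2 => 1.21
  | _ + 3 => 1.29

theorem one_le_xw (m : ℕ) : 1 ≤ xw m := by
  rcases m with _ | _ | _ | m <;> norm_num [xw]

theorem xw_le (m : ℕ) : xw m ≤ 1.29 := by
  rcases m with _ | _ | _ | m <;> norm_num [xw]

theorem xw_mono : Monotone xw := by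
  refine monotone_nat_of_le_succ fun m => ?_
  rcases m with _ | _ | _ | m <;> norm_num [xw]

/-- The weight of a vertex. -/
noncomputable def phi (U C : Finset V) (u : V) : ℝ :=
  if u ∈ U then (if u ∈ C ∧ (G.neighborFinset u ∩ U).Nonempty then 1.9332 else 1.7755)
  else if u ∈ C then xw #(G.neighborFinset u ∩ U) else 1

/-- The weight of a pair of vertex sets. -/
noncomputable def weight (U C : Finset V) : ℝ := ∏ u, phi G U C u

theorem one_le_phi (U C : Finset V) (u : V) : 1 ≤ phi G U C u := by
  unfold phi
  split_ifs <;> first | exact one_le_xw _ | norm_num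

theorem weight_pos (U C : Finset V) : 0 < weight G U C :=
  prod_pos fun u _ => one_pos.trans_le (one_le_phi G U C u)

variable {U U' C C' : Finset V}

/-- Thanks to monotonicity, a branch only has to account for the vertices whose loss of weight is
needed; all others contribute a factor of at most 1. -/
theorem phi_mono (hU : U' ⊆ U) (hC : C' ⊆ C) (u : V) : phi G U' C' u ≤ phi G U C u := by
  have hN : G.neighborFinset u ∩ U' ⊆ G.neighborFinset u ∩ U := inter_subset_inter_left hU
  by_cases h1 : u ∈ U'
  · have h2 := hU h1
    simp only [phi, h1, h2, if_true]
    split_ifs with h3 h4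
    · exact le_rfl
    · exact absurd ⟨hC h3.1, h3.2.mono hN⟩ h4
    · norm_num
    · exact le_rfl
  · by_cases h2 : u ∈ U
    · by_cases h3 : u ∈ C'
      · simp only [phi, h1, h2, h3, hC h3, if_true, if_false, true_and]
        split_ifs with h4
        · exact (xw_le _).trans (by norm_num)
        · rw [not_nonempty_iff_eq_empty] at h4
          rw [h4, subset_empty] at hN
          norm_num [hN, xw]
      · have : phi G U' C' u = 1 := by simp [phi, h1, h3]
        rw [this]; exact one_le_phi G U C u
    · by_cases h3 : u ∈ C'
      · simp only [phi, h1, h2, h3, hC h3, if_true, if_false]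
        exact xw_mono (card_le_card hN)
      · have : phi G U' C' u = 1 := by simp [phi, h1, h3]
        rw [this]; exact one_le_phi G U C u

theorem weight_mono (hU : U' ⊆ U) (hC : C' ⊆ C) : weight G U' C' ≤ weight G U C :=
  prod_le_prod (fun u _ => zero_le_one.trans (one_le_phi G _ _ u))
    fun u _ => phi_mono G hU hC u

/-- The factor by which the weight of a vertex that loses its role in `C` decreases. -/
noncomputable abbrev kap : ℝ := 1.7755 / 1.9332

/-- The factor by which the weight of a vertex that loses its role in `U` decreases. -/
noncomputable abbrev chi : ℝ := 1.29 / 1.9332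

theorem phi_of_kill {u : V} (hu : u ∈ U) (huC : u ∈ C) (hN : (G.neighborFinset u ∩ U).Nonempty)
    (h : u ∉ C') : phi G U' C' u ≤ kap * phi G U C u := by
  simp only [phi, hu, huC, hN, h, if_true, if_false, false_and, and_self, kap]
  split_ifs <;> norm_num

/-- The worst case is a drop from 1.9332 to 1.29. A vertex of weight 1.7755 is outside `C` or has no
neighbour in `U`, so it drops to 1. -/
theorem phi_of_out {u : V} (hu : u ∈ U) (h : u ∉ U') (hU : U' ⊆ U) (hC : C' ⊆ C) :
    phi G U' C' u ≤ chi * phi G U C u := by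
  have hN : G.neighborFinset u ∩ U' ⊆ G.neighborFinset u ∩ U := inter_subset_inter_left hU
  by_cases h1 : u ∈ C'
  · simp only [phi, hu, h, h1, hC h1, if_true, if_false, true_and, chi]
    split_ifs with h4
    · exact (xw_le _).trans (by norm_num)
    · rw [not_nonempty_iff_eq_empty] at h4
      rw [h4, subset_empty] at hN
      norm_num [hN, xw]
  · simp only [phi, hu, h, h1, if_true, if_false, chi]
    split_ifs <;> norm_num

theorem phi_eq_one {u : V} (h1 : u ∉ U) (h2 : u ∉ C) : phi G U C u = 1 := by
  simp [phi, h1, h2]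

theorem phi_eq_c {u : V} (h1 : u ∈ U) (h2 : u ∈ C) (h3 : (G.neighborFinset u ∩ U).Nonempty) :
    phi G U C u = 1.9332 := by
  simp [phi, h1, h2, h3]

theorem phi_eq_y {u : V} (h1 : u ∈ U) (h2 : u ∉ C) : phi G U C u = 1.7755 := by
  simp [phi, h1, h2]

theorem phi_eq_xw {u : V} (h1 : u ∉ U) (h2 : u ∈ C) :
    phi G U C u = xw #(G.neighborFinset u ∩ U) := by
  simp [phi, h1, h2]

/-- Bookkeeping for all branches: two distinguished vertices and two sets carry extra factors. Slots
that are not needed receive the factor 1 or the empty set. -/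
theorem weight_le_of_phi_le (v w : V) (S T : Finset V) {a d b g r : ℝ}
    (hr : a * d * b ^ #S * g ^ #T = r)
    (h : ∀ u, phi G U' C' u ≤ (if u = v then a else 1) * (if u = w then d else 1) *
      (if u ∈ S then b else 1) * (if u ∈ T then g else 1) * phi G U C u) :
    weight G U' C' ≤ r * weight G U C := by
  refine (prod_le_prod (fun u _ => zero_le_one.trans (one_le_phi G _ _ u))
    fun u _ => h u).trans_eq ?_
  simp only [prod_mul_distrib, weight]
  simp [prod_ite_mem, prod_ite_eq', ← hr]

end PrivateNeighbors

namespace PrivateNeighbors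

open Finset

variable {V : Type*} [Fintype V] [DecidableEq V] (G : SimpleGraph V) [DecidableRel G.Adj]

/-! ### Branching -/

variable {U C : Finset V}

theorem count_le_of_kill (IH : ∀ U' C' : Finset V, #U' + #C' < #U + #C →
      (count G U' C' : ℝ) ≤ weight G U' C') {v : V} (hv : v ∈ U) {a b : ℝ}
    (ha : weight G (U.erase v) C ≤ a * weight G U C)
    (hb : weight G (U.erase v) (C \ insert v (G.neighborFinset v)) ≤ b * weight G U C)
    (hab : a + b ≤ 1) : (count G U C : ℝ) ≤ weight G U C := by
  have h1 : (count G U C : ℝ) ≤ count G (U.erase v) C + countIn G v U C := by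
    exact_mod_cast count_le_add G v U C
  have h2 : (countIn G v U C : ℝ) ≤
      count G (U.erase v) (C \ insert v (G.neighborFinset v)) := by
    exact_mod_cast countIn_le G v U C
  have hc := card_erase_lt_of_mem hv
  have h3 := IH (U.erase v) C (by omega)
  have h4 := IH (U.erase v) (C \ insert v (G.neighborFinset v))
    (by have := card_le_card (sdiff_subset (s := C) (t := insert v (G.neighborFinset v))); omega)
  nlinarith [weight_pos G U C]

theorem count_le_of_private (IH : ∀ U' C' : Finset V, #U' + #C' < #U + #C →
      (count G U' C' : ℝ) ≤ weight G U' C') {v : V} (hv : v ∈ U) {a b : ℝ}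
    (ha : weight G (U.erase v) C ≤ a * weight G U C)
    (hb : ∀ p ∈ C ∩ G.neighborFinset v,
      weight G (U \ insert p (G.neighborFinset p)) (C \ insert v (G.neighborFinset v)) ≤
        b * weight G U C)
    (hab : a + #(C ∩ G.neighborFinset v) * b ≤ 1) : (count G U C : ℝ) ≤ weight G U C := by
  have h1 : (count G U C : ℝ) ≤ count G (U.erase v) C + countIn G v U C := by
    exact_mod_cast count_le_add G v U C
  have h2 : (countIn G v U C : ℝ) ≤ ∑ p ∈ C ∩ G.neighborFinset v,
      (count G (U \ insert p (G.neighborFinset p)) (C \ insert v (G.neighborFinset v)) : ℝ) := by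
    exact_mod_cast countIn_le_sum G v U C
  have hc := card_erase_lt_of_mem hv
  have h3 := IH (U.erase v) C (by omega)
  have h4 : ∑ p ∈ C ∩ G.neighborFinset v,
      (count G (U \ insert p (G.neighborFinset p)) (C \ insert v (G.neighborFinset v)) : ℝ) ≤
      ∑ p ∈ C ∩ G.neighborFinset v, b * weight G U C := by
    refine sum_le_sum fun p hp => (IH _ _ ?_).trans (hb p hp)
    have e1 : #(U \ insert p (G.neighborFinset p)) ≤ #(U.erase v) := by
      refine card_le_card fun u hu => ?_
      simp only [mem_sdiff, mem_insert, SimpleGraph.mem_neighborFinset, not_or, mem_inter] at hu hp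
      refine mem_erase.2 ⟨?_, hu.1⟩
      rintro rfl
      exact hu.2.2 hp.2.symm
    have := card_le_card (sdiff_subset (s := C) (t := insert v (G.neighborFinset v)))
    omega
  rw [sum_const, nsmul_eq_mul] at h4
  nlinarith [weight_pos G U C]

theorem one_le_inv_mul_phi (U C : Finset V) (v : V) :
    1 ≤ (phi G U C v)⁻¹ * phi G U C v :=
  (inv_mul_cancel₀ (one_pos.trans_le (one_le_phi G U C v)).ne').ge

theorem weight_erase_le {v : V} (hv : v ∈ U) : weight G (U.erase v) C ≤ chi * weight G U C := by
  refine weight_le_of_phi_le G v v ∅ ∅ (a := chi) (d := 1) (b := 1) (g := 1) (by simp)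
    fun u => ?_
  by_cases h : u = v
  · subst h
    simpa using phi_of_out G hv (notMem_erase u U) (erase_subset u U) subset_rfl
  · simpa [h] using phi_mono G (erase_subset v U) (subset_refl C) u

theorem weight_erase_le_of_outer {v w : V} (hv : v ∈ U) (hw : w ∉ U) {a d : ℝ}
    (ha : phi G (U.erase v) C v ≤ a * phi G U C v)
    (hd : phi G (U.erase v) C w ≤ d * phi G U C w) :
    weight G (U.erase v) C ≤ a * d * weight G U C := by
  have hne : w ≠ v := fun h => hw (h ▸ hv)
  refine weight_le_of_phi_le G v w ∅ ∅ (a := a) (d := d) (b := 1) (g := 1) (by simp)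
    fun u => ?_
  by_cases h : u = v
  · subst h
    simpa [hne.symm] using ha
  by_cases h' : u = w
  · subst h'
    simpa [h] using hd
  · simpa [h, h'] using phi_mono G (erase_subset v U) (subset_refl C) u

theorem weight_kill_le {v : V} (hN : ∀ p ∈ C, (G.neighborFinset p ∩ U).Nonempty)
    {S : Finset V} (hS : S ⊆ C ∩ G.neighborFinset v) (hSU : S ⊆ U) :
    weight G (U.erase v) (C \ insert v (G.neighborFinset v)) ≤
      (phi G U C v)⁻¹ * kap ^ #S * weight G U C := by
  refine weight_le_of_phi_le G v v S ∅ (a := (phi G U C v)⁻¹) (d := 1) (b := kap) (g := 1)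
    (by simp) fun u => ?_
  by_cases h : u = v
  · subst h
    have : u ∉ S := fun h => by simpa using hS h
    rw [phi_eq_one G (notMem_erase u U) (by simp)]
    simpa [this] using one_le_inv_mul_phi G U C u
  by_cases h' : u ∈ S
  · have h1 := mem_inter.1 (hS h')
    simpa [h, h'] using phi_of_kill G (hSU h') h1.1 (hN u h1.1) (by simp_all)
  · simpa [h, h'] using phi_mono G (erase_subset v U) sdiff_subset u

theorem weight_kill_le_of_outer {v w : V} (hv : v ∈ U)
    (hN : ∀ p ∈ C, (G.neighborFinset p ∩ U).Nonempty) (hw : w ∉ U) (hvw : G.Adj v w)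
    {S : Finset V} (hS : S ⊆ C ∩ G.neighborFinset v) (hSU : S ⊆ U) :
    weight G (U.erase v) (C \ insert v (G.neighborFinset v)) ≤
      (phi G U C v)⁻¹ * (phi G U C w)⁻¹ * kap ^ #S * weight G U C := by
  have hne : w ≠ v := fun h => hw (h ▸ hv)
  refine weight_le_of_phi_le G v w S ∅ (a := (phi G U C v)⁻¹) (d := (phi G U C w)⁻¹)
    (b := kap) (g := 1) (by simp) fun u => ?_
  by_cases h : u = v
  · subst h
    have : u ∉ S := fun h => by simpa using hS h
    rw [phi_eq_one G (notMem_erase u U) (by simp)]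
    simpa [this, hne.symm] using one_le_inv_mul_phi G U C u
  by_cases h1 : u = w
  · subst h1
    have : u ∉ S := fun h => hw (hSU h)
    rw [phi_eq_one G (fun h => hw (mem_of_mem_erase h)) (by simp [hvw])]
    simpa [this, h] using one_le_inv_mul_phi G U C u
  by_cases h' : u ∈ S
  · have h2 := mem_inter.1 (hS h')
    simpa [h, h', h1] using phi_of_kill G (hSU h') h2.1 (hN u h2.1) (by simp_all)
  · simpa [h, h', h1] using phi_mono G (erase_subset v U) sdiff_subset u

/-- Both `v` and `p` lose all their weight; the vertices of `S`, being neighbours of `v`, leave `C`,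
and those of `T`, being neighbours of `p`, leave `U`. -/
theorem weight_private_le {v p : V} (hv : v ∈ U)
    (hN : ∀ p ∈ C, (G.neighborFinset p ∩ U).Nonempty) (hpC : p ∈ C) (hpU : p ∈ U)
    (hvp : G.Adj v p) {S T : Finset V} (hS : S ⊆ (C ∩ G.neighborFinset v).erase p) (hSU : S ⊆ U)
    (hT : T ⊆ (G.neighborFinset p ∩ U).erase v) :
    weight G (U \ insert p (G.neighborFinset p)) (C \ insert v (G.neighborFinset v)) ≤
      (phi G U C v)⁻¹ * (1 / 1.9332) * kap ^ #S * chi ^ #T * weight G U C := by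
  have hne : p ≠ v := hvp.ne'
  refine weight_le_of_phi_le G v p S T (a := (phi G U C v)⁻¹) (d := 1 / 1.9332)
    (b := kap) (g := chi) rfl fun u => ?_
  have hS' : ∀ u ∈ S, u ≠ p ∧ u ≠ v ∧ u ∈ C ∧ G.Adj v u := fun u hu => by
    have := hS hu
    simp only [mem_erase, mem_inter, SimpleGraph.mem_neighborFinset] at this
    exact ⟨this.1, this.2.2.ne', this.2.1, this.2.2⟩
  have hT' : ∀ u ∈ T, u ≠ p ∧ u ≠ v ∧ u ∈ U ∧ G.Adj p u := fun u hu => by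
    have := hT hu
    simp only [mem_erase, mem_inter, SimpleGraph.mem_neighborFinset] at this
    exact ⟨this.2.1.ne', this.1, this.2.2, this.2.1⟩
  by_cases h : u = v
  · subst h
    have h1 : u ∉ S := fun h => (hS' u h).2.1 rfl
    have h2 : u ∉ T := fun h => (hT' u h).2.1 rfl
    rw [phi_eq_one G (by simp [hvp.symm]) (by simp)]
    simpa [h1, h2, hne.symm] using one_le_inv_mul_phi G U C u
  by_cases h' : u = p
  · subst h'
    have h1 : u ∉ S := fun h => (hS' u h).1 rfl
    have h2 : u ∉ T := fun h => (hT' u h).1 rfl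
    rw [phi_eq_one G (by simp) (by simp [hvp]), phi_eq_c G hpU hpC (hN u hpC)]
    norm_num [h1, h2, h]
  by_cases h1 : u ∈ S <;> by_cases h2 : u ∈ T
  -- A vertex in both sets drops to weight 1, which is even less than `kap * chi * 1.9332`.
  · have h3 := hS' u h1
    have h4 := hT' u h2
    rw [phi_eq_one G (by simp [h4]) (by simp [h3]), phi_eq_c G (hSU h1) h3.2.2.1 (hN u h3.2.2.1)]
    norm_num [h1, h2, h, h']
  · have h3 := hS' u h1
    simpa [h1, h2, h, h'] using phi_of_kill G (hSU h1) h3.2.2.1 (hN u h3.2.2.1) (by simp [h3])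
  · have h4 := hT' u h2
    simpa [h1, h2, h, h'] using phi_of_out G h4.2.2.1 (by simp [h4]) sdiff_subset sdiff_subset
  · simpa [h1, h2, h, h'] using phi_mono G sdiff_subset sdiff_subset u

theorem kap_pow_le {m k : ℕ} (h : m ≤ k) : kap ^ k ≤ kap ^ m :=
  pow_le_pow_of_le_one (by norm_num) (by norm_num) h

theorem phi_erase_outer {v w : V} (hv : v ∈ U) (hw : w ∉ U) (hwC : w ∈ C) (hvw : G.Adj v w) :
    phi G (U.erase v) C w =
      xw (#(G.neighborFinset w ∩ U) - 1) / xw #(G.neighborFinset w ∩ U) * phi G U C w := by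
  have : 0 < xw #(G.neighborFinset w ∩ U) := one_pos.trans_le (one_le_xw _)
  rw [phi_eq_xw G (fun h => hw (mem_of_mem_erase h)) hwC, phi_eq_xw G hw hwC, inter_erase,
    card_erase_of_mem (by simp [hvw.symm, hv]), div_mul_cancel₀ _ this.ne']

/-- A vertex of `U \ C` with a neighbour in `C \ U`. -/
theorem count_le_of_free_of_outer (IH : ∀ U' C' : Finset V, #U' + #C' < #U + #C →
      (count G U' C' : ℝ) ≤ weight G U' C') (hN : ∀ p ∈ C, (G.neighborFinset p ∩ U).Nonempty)
    {v w : V} (hv : v ∈ U) (hvC : v ∉ C)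
    (hw : w ∉ U) (hwC : w ∈ C) (hvw : G.Adj v w) : (count G U C : ℝ) ≤ weight G U C := by
  have hm1 : 1 ≤ #(G.neighborFinset w ∩ U) := card_pos.2 (hN w hwC)
  refine count_le_of_kill G IH hv (weight_erase_le_of_outer G hv hw (a := 1 / 1.7755) ?_
    (phi_erase_outer G hv hw hwC hvw).le) (weight_kill_le_of_outer G hv hN hw hvw
      (empty_subset _) (empty_subset _)) ?_
  · rw [phi_eq_one G (notMem_erase v U) hvC, phi_eq_y G hv hvC]
    norm_num
  -- What is needed is `xw (m - 1) + 1 ≤ 1.7755 * xw m`. It is nearly tight for `m ≥ 4`, where it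
  -- reads `2.29 ≤ 2.290395`.
  · rw [phi_eq_y G hv hvC, phi_eq_xw G hw hwC]
    generalize #(G.neighborFinset w ∩ U) = m at hm1
    rcases m with _ | _ | _ | _ | m
    · omega
    all_goals norm_num [xw]

/-- A vertex of `U \ C` all of whose neighbours in `C` belong to `U`. -/
theorem count_le_of_free (IH : ∀ U' C' : Finset V, #U' + #C' < #U + #C →
      (count G U' C' : ℝ) ≤ weight G U' C') (hN : ∀ p ∈ C, (G.neighborFinset p ∩ U).Nonempty)
    {v : V} (hv : v ∈ U) (hvC : v ∉ C) (hne : (C ∩ G.neighborFinset v).Nonempty)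
    (hD : C ∩ G.neighborFinset v ⊆ U) : (count G U C : ℝ) ≤ weight G U C := by
  have hout : weight G (U.erase v) C ≤ 1 / 1.7755 * weight G U C := by
    refine weight_le_of_phi_le G v v ∅ ∅ (a := 1 / 1.7755) (d := 1) (b := 1) (g := 1) (by simp)
      fun u => ?_
    by_cases h : u = v
    · subst h
      rw [phi_eq_one G (notMem_erase u U) hvC, phi_eq_y G hv hvC]
      norm_num
    · simpa [h] using phi_mono G (erase_subset v U) (subset_refl C) u
  have hkill := weight_kill_le G hN (v := v) subset_rfl hD
  rw [phi_eq_y G hv hvC] at hkill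
  have hpos := card_pos.2 hne
  obtain h | h | h : #(C ∩ G.neighborFinset v) = 1 ∨ #(C ∩ G.neighborFinset v) = 2 ∨
    3 ≤ #(C ∩ G.neighborFinset v) := by omega
  · refine count_le_of_private G IH hv hout (b := 1 / 1.7755 * (1 / 1.9332)) (fun p hp => ?_) ?_
    · have := weight_private_le G hv hN (mem_inter.1 hp).1 (hD hp) (by simpa using (mem_inter.1 hp).2)
        (empty_subset _) (empty_subset _) (T := ∅)
      simpa [phi_eq_y G hv hvC] using this
    · norm_num [h]
  -- With two neighbours, plain branching is too weak. A `p` whose only neighbour in `U` is `v`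
  -- falls to 1.7755 once `v` is discarded, which gains a factor `kap` in that branch. If there is
  -- no such `p`, each choice of a private neighbour `p` expels a further vertex from `U`, which
  -- gains `chi`.
  · by_cases h1 : ∃ p ∈ C ∩ G.neighborFinset v, G.neighborFinset p ∩ U = {v}
    · obtain ⟨p, hp, hpv⟩ := h1
      have hpC := (mem_inter.1 hp).1
      refine count_le_of_kill G IH hv (a := 1 / 1.7755 * kap) ?_ hkill ?_
      · refine weight_le_of_phi_le G v p ∅ ∅ (a := 1 / 1.7755) (d := kap) (b := 1) (g := 1)
          (by simp) fun u => ?_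
        have hvp : v ≠ p := fun h => by subst h; simp at hp
        by_cases h : u = v
        · subst h
          rw [phi_eq_one G (notMem_erase u U) hvC, phi_eq_y G hv hvC]
          norm_num [hvp]
        by_cases h' : u = p
        · subst h'
          have : ¬ (G.neighborFinset u ∩ U.erase v).Nonempty := by
            rw [inter_erase, hpv]; simp
          rw [phi_eq_c G (hD hp) hpC (hN u hpC)]
          simp only [phi, mem_erase, h, hD hp, this]
          norm_num [h]
        · simpa [h, h'] using phi_mono G (erase_subset v U) (subset_refl C) u
      · rw [h]; norm_num
    · push Not at h1
      refine count_le_of_private G IH hv hout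
        (b := 1 / 1.7755 * (1 / 1.9332) * kap * chi) (fun p hp => ?_) ?_
      · have hvp : G.Adj v p := by simpa using (mem_inter.1 hp).2
        obtain ⟨q, hq⟩ : ((G.neighborFinset p ∩ U).erase v).Nonempty := by
          rw [nonempty_iff_ne_empty, Ne, erase_eq_empty_iff]
          rintro (h | h)
          · exact (hN p (mem_inter.1 hp).1).ne_empty h
          · exact h1 p hp h
        have := weight_private_le G hv hN (mem_inter.1 hp).1 (hD hp) hvp
          subset_rfl ((erase_subset _ _).trans hD) (singleton_subset_iff.2 hq)
        simpa [phi_eq_y G hv hvC, card_erase_of_mem hp, h] using this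
      · norm_num [h]
  · refine count_le_of_kill G IH hv hout hkill ?_
    -- Three neighbours that leave `C` suffice: `1 + kap ^ 3 ≤ 1.7755`.
    have := kap_pow_le h
    have h3 : kap ^ 3 ≤ 0.7755 := by norm_num
    have : kap ^ #(C ∩ G.neighborFinset v) ≤ 0.7755 := this.trans h3
    linarith

/-- A vertex of `U ∩ C` with a neighbour in `C \ U`. -/
theorem count_le_of_outer (IH : ∀ U' C' : Finset V, #U' + #C' < #U + #C →
      (count G U' C' : ℝ) ≤ weight G U' C') (hN : ∀ p ∈ C, (G.neighborFinset p ∩ U).Nonempty)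
    (hUC : U ⊆ C) {v w : V} (hv : v ∈ U) (hw : w ∉ U) (hwC : w ∈ C) (hvw : G.Adj v w) :
    (count G U C : ℝ) ≤ weight G U C := by
  have hm1 : 1 ≤ #(G.neighborFinset w ∩ U) := card_pos.2 (hN w hwC)
  have hk1 : 1 ≤ #(G.neighborFinset v ∩ U) := card_pos.2 (hN v (hUC hv))
  have hin := weight_kill_le_of_outer G hv hN hw hvw (S := G.neighborFinset v ∩ U)
    (fun u hu => mem_inter.2 ⟨hUC (mem_inter.1 hu).2, (mem_inter.1 hu).1⟩) inter_subset_right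
  refine count_le_of_kill G IH hv (weight_erase_le_of_outer G hv hw
    (a := xw #(G.neighborFinset v ∩ U) / 1.9332) ?_ (phi_erase_outer G hv hw hwC hvw).le) hin ?_
  · rw [phi_eq_xw G (notMem_erase v U) (hUC hv), phi_eq_c G hv (hUC hv) (hN v (hUC hv)),
      inter_erase, erase_eq_of_notMem (by simp)]
    norm_num
  · rw [phi_eq_c G hv (hUC hv) (hN v (hUC hv)), phi_eq_xw G hw hwC]
    generalize #(G.neighborFinset w ∩ U) = m at hm1
    generalize #(G.neighborFinset v ∩ U) = k at hk1
    have hx := one_le_xw m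
    obtain ⟨q, hq, hkq, hx3⟩ : ∃ q : ℝ, kap ^ k ≤ q ∧ 0 ≤ q ∧
        xw k * xw (m - 1) + q ≤ 1.9332 * xw m := by
      -- Since `xw` is constant from 3 on, capping the exponent at 3 leaves finitely many numerical
      -- cases.
      refine ⟨kap ^ (min k 3), kap_pow_le (min_le_left _ _), by positivity, ?_⟩
      rcases m with _ | _ | _ | _ | m
      · omega
      all_goals
        rcases k with _ | _ | _ | k
        · omega
        all_goals norm_num [xw]
    have : xw k / 1.9332 * (xw (m - 1) / xw m) + (1.9332)⁻¹ * (xw m)⁻¹ * kap ^ k =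
        (xw k * xw (m - 1) + kap ^ k) / (1.9332 * xw m) := by
      field_simp
    rw [this, div_le_one (by positivity)]
    exact (add_le_add le_rfl hq).trans hx3

/-- From `k` to `k + 1` the left side is multiplied by `q * (k + 3) / (k + 2)`, which is at most 1
for `q ≤ 2 / 3`. Hence degree 2 is the worst among all degrees of at least 2. -/
theorem mul_pow_le {q : ℝ} (h0 : 0 ≤ q) (h1 : q ≤ 1 / 2 + 1 / 6) (k : ℕ) :
    (k + 2) * q ^ (k + 1) ≤ 2 * q := by
  induction k with
  | zero => simp
  | succ k ih =>
    refine le_trans ?_ ih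
    have : 0 ≤ q ^ (k + 1) := by positivity
    have h2 : ((k + 1 : ℕ) + 2 : ℝ) * q ≤ k + 2 := by push_cast; nlinarith
    calc ((k + 1 : ℕ) + 2 : ℝ) * q ^ (k + 1 + 1)
        = (((k + 1 : ℕ) + 2 : ℝ) * q) * q ^ (k + 1) := by ring
      _ ≤ _ := by gcongr

/-- The case of equal sets, in which a vertex of minimum degree is chosen. -/
theorem count_le_of_eq (IH : ∀ U' C' : Finset V, #U' + #C' < #U + #U →
      (count G U' C' : ℝ) ≤ weight G U' C') (hN : ∀ p ∈ U, (G.neighborFinset p ∩ U).Nonempty)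
    (hU : U.Nonempty) : (count G U U : ℝ) ≤ weight G U U := by
  obtain ⟨v, hv, hmin⟩ := exists_min_image U (fun u => #(G.neighborFinset u ∩ U)) hU
  have hcard : #(U ∩ G.neighborFinset v) = #(G.neighborFinset v ∩ U) := by rw [inter_comm]
  have hk1 : 1 ≤ #(G.neighborFinset v ∩ U) := card_pos.2 (hN v hv)
  obtain ⟨k, hk⟩ : ∃ k, #(G.neighborFinset v ∩ U) = k + 1 := ⟨_, (Nat.sub_add_cancel hk1).symm⟩
  refine count_le_of_private G IH hv (weight_erase_le G hv)
    (b := 1 / 1.9332 * (1 / 1.9332) * (kap * chi) ^ k) (fun p hp => ?_) ?_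
  · obtain ⟨hpU, hvp⟩ := mem_inter.1 hp
    have hvp : G.Adj v p := by simpa using hvp
    -- By the choice of `v`, every `p` has at least `k` neighbours in `U` besides `v`; they all
    -- leave `U` when `p` is private for `v`.
    have h1 : k ≤ #((G.neighborFinset p ∩ U).erase v) := by
      rw [card_erase_of_mem (by simp [hvp.symm, hv])]
      have := hmin p hpU
      omega
    obtain ⟨T, hT, hTk⟩ := exists_subset_card_eq h1
    have := weight_private_le G hv hN hpU hpU hvp subset_rfl
      ((erase_subset _ _).trans inter_subset_left) hT
    rw [card_erase_of_mem hp, hcard, hk, hTk, phi_eq_c G hv hv (hN v hv)] at this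
    refine this.trans_eq ?_
    rw [Nat.add_sub_cancel, mul_pow]
    generalize kap ^ k = a, chi ^ k = b
    ring
  · rw [hcard, hk]
    rcases k with _ | k
    · norm_num
    · have h2 := mul_pow_le (q := kap * chi) (by norm_num) (by norm_num) k
      have h3 : 2 * (kap * chi) ≤ 1.2258 := by norm_num
      have h4 : ((k + 2 : ℝ)) * (kap * chi) ^ (k + 1) ≤ 1.2258 := h2.trans h3
      generalize (kap * chi) ^ (k + 1) = z at h4
      push_cast
      norm_num [chi] at h4 ⊢
      linarith

/-- Induction on the total size. A vertex of `C` without neighbour in `U` cannot be private and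
leaves `C`; a vertex of `U` without neighbour in `C` cannot be a member and leaves `U`. When neither
occurs, one of the branching cases applies, according to the inclusions between `U` and `C`. -/
theorem count_le_weight (U C : Finset V) : (count G U C : ℝ) ≤ weight G U C := by
  induction h : #U + #C using Nat.strong_induction_on generalizing U C with
  | _ m IH =>
  have IH : ∀ U' C' : Finset V, #U' + #C' < #U + #C → (count G U' C' : ℝ) ≤ weight G U' C' :=
    fun U' C' h' => IH _ (h ▸ h') U' C' rfl
  by_cases hN : ∀ p ∈ C, (G.neighborFinset p ∩ U).Nonempty
  swap
  · push Not at hN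
    obtain ⟨p, hp, hN⟩ := hN
    have h1 : (count G U C : ℝ) ≤ count G U (C.erase p) := by
      exact_mod_cast count_le_erase_right G C hN
    exact (h1.trans (IH _ _ (by have := card_erase_lt_of_mem hp; omega))).trans
      (weight_mono G subset_rfl (erase_subset p C))
  by_cases hM : ∀ v ∈ U, (C ∩ G.neighborFinset v).Nonempty
  swap
  · push Not at hM
    obtain ⟨v, hv, hM⟩ := hM
    have h0 := countIn_le_sum G v U C
    have h1 := count_le_add G v U C
    rw [hM, sum_empty] at h0
    have h2 : (count G U C : ℝ) ≤ count G (U.erase v) C := by exact_mod_cast (by omega)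
    exact (h2.trans (IH _ _ (by have := card_erase_lt_of_mem hv; omega))).trans
      (weight_mono G (erase_subset v U) subset_rfl)
  by_cases hUC : U ⊆ C
  · by_cases hCU : C ⊆ U
    · obtain rfl := subset_antisymm hUC hCU
      rcases U.eq_empty_or_nonempty with rfl | hU
      · have : count G ∅ ∅ ≤ 1 := by
          unfold count
          exact (card_filter_le _ _).trans (by simp)
        have : (count G ∅ ∅ : ℝ) ≤ 1 := by exact_mod_cast this
        exact this.trans (by simp [weight, phi])
      · exact count_le_of_eq G IH hN hU
    · obtain ⟨w, hwC, hw⟩ := not_subset.1 hCU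
      obtain ⟨v, hv⟩ := hN w hwC
      simp only [mem_inter, SimpleGraph.mem_neighborFinset] at hv
      exact count_le_of_outer G IH hN hUC hv.2 hw hwC hv.1.symm
  · obtain ⟨v, hv, hvC⟩ := not_subset.1 hUC
    by_cases hD : C ∩ G.neighborFinset v ⊆ U
    · exact count_le_of_free G IH hN hv hvC (hM v hv) hD
    · obtain ⟨w, hw, hwU⟩ := not_subset.1 hD
      simp only [mem_inter, SimpleGraph.mem_neighborFinset] at hw
      exact count_le_of_free_of_outer G IH hN hv hvC hwU hw.1 hw.2

theorem count_univ_le : (count G univ univ : ℝ) ≤ 1.9332 ^ Fintype.card V := by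
  refine (count_le_weight G univ univ).trans ?_
  rw [Fintype.card, ← prod_const]
  refine prod_le_prod (fun u _ => zero_le_one.trans (one_le_phi G _ _ u)) fun u _ => ?_
  simp only [phi, mem_univ, if_true, true_and]
  split_ifs <;> norm_num

end PrivateNeighbors

/-! ### Reasoning about programs -/

namespace RAM

/-- At most the first `m` registers are in use, and they hold numbers of at most `m` bits. -/
def Fits (m : ℕ) (σ : Memory) : Prop := ∀ a, σ a ≠ 0 → a < m ∧ σ a < 2 ^ m

/-- `Silent inp m c k c'` says that `k` steps without output lead from `c` to `c'`, within
space `m`. -/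
inductive Silent (inp : List ℕ) (m : ℕ) : Config → ℕ → Config → Prop
  | refl (c : Config) : Silent inp m c 0 c
  | head {c c' : Config} {k : ℕ} (h1 : c.todo ≠ []) (h2 : Fits m c.mem)
      (h3 : emitted inp c = none) (h4 : Silent inp m (step inp c) k c') :
      Silent inp m c (k + 1) c'

variable {inp : List ℕ} {m : ℕ}

theorem Silent.trans {c c' c'' : Config} {k l : ℕ} (h : Silent inp m c k c')
    (h' : Silent inp m c' l c'') : Silent inp m c (k + l) c'' := by
  induction h with
  | refl c => simpa using h'
  | head h1 h2 h3 _ ih =>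
    rw [Nat.add_right_comm]
    exact .head h1 h2 h3 (ih h')

/-- `Exec inp m P σ σ' N` says that `P` leads without output from the memory `σ` to the memory
`σ'` in at most `N` steps, within space `m`. -/
def Exec (inp : List ℕ) (m : ℕ) (P : Program) (σ σ' : Memory) (N : ℕ) : Prop :=
  ∃ k ≤ N, ∀ K, Silent inp m ⟨P :: K, σ⟩ k ⟨K, σ'⟩

namespace Exec

variable {P Q : Program} {σ σ' σ'' : Memory} {e a : Expr} {N N' : ℕ}

theorem mono (h : Exec inp m P σ σ' N) (hN : N ≤ N') : Exec inp m P σ σ' N' := by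
  obtain ⟨k, hk, h⟩ := h
  exact ⟨k, hk.trans hN, h⟩

theorem skip (h : Fits m σ) : Exec inp m .skip σ σ 1 :=
  ⟨1, le_rfl, fun _ => .head (by simp) h rfl (.refl _)⟩

theorem store (h : Fits m σ)
    (h' : Function.update σ (a.eval inp σ) (e.eval inp σ) = σ') :
    Exec inp m (.store a e) σ σ' 1 :=
  ⟨1, le_rfl, fun _ => .head (by simp) h rfl (h' ▸ .refl _)⟩

theorem seq (h : Fits m σ) (hP : Exec inp m P σ σ' N) (hQ : Exec inp m Q σ' σ'' N') :
    Exec inp m (.seq P Q) σ σ'' (N + N' + 1) := by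
  obtain ⟨k, hk, hP⟩ := hP
  obtain ⟨l, hl, hQ⟩ := hQ
  exact ⟨k + l + 1, by omega, fun K => .head (by simp) h rfl ((hP _).trans (hQ _))⟩

theorem cond_true (h : Fits m σ) (he : e.eval inp σ ≠ 0) (hP : Exec inp m P σ σ' N) :
    Exec inp m (.cond e P Q) σ σ' (N + 1) := by
  obtain ⟨k, hk, hP⟩ := hP
  refine ⟨k + 1, by omega, fun K => .head (by simp) h rfl ?_⟩
  simpa [step, he] using hP K

theorem cond_false (h : Fits m σ) (he : e.eval inp σ = 0) (hQ : Exec inp m Q σ σ' N) :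
    Exec inp m (.cond e P Q) σ σ' (N + 1) := by
  obtain ⟨k, hk, hQ⟩ := hQ
  refine ⟨k + 1, by omega, fun K => .head (by simp) h rfl ?_⟩
  simpa [step, he] using hQ K

theorem loop_end (h : Fits m σ) (he : e.eval inp σ = 0) : Exec inp m (.loop e P) σ σ 1 := by
  refine ⟨1, le_rfl, fun K => .head (by simp) h rfl ?_⟩
  simpa [step, he] using Silent.refl _

theorem loop_step (h : Fits m σ) (he : e.eval inp σ ≠ 0) (hP : Exec inp m P σ σ' N)
    (hQ : Exec inp m (.loop e P) σ' σ'' N') : Exec inp m (.loop e P) σ σ'' (N + N' + 1) := by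
  obtain ⟨k, hk, hP⟩ := hP
  obtain ⟨l, hl, hQ⟩ := hQ
  refine ⟨k + l + 1, by omega, fun K => .head (by simp) h rfl ?_⟩
  have := (hP (.loop e P :: K)).trans (hQ K)
  simpa [step, he] using this

/-- A loop that counts from `k` to `n`. -/
theorem counting_loop {S : Type*} {mem : S → Memory} {n : ℕ} {Inv : ℕ → S → Prop}
    (hfit : ∀ k s, Inv k s → Fits m (mem s))
    (he : ∀ k s, Inv k s → k ≤ n → e.eval inp (mem s) = n - k)
    (hP : ∀ k < n, ∀ s, Inv k s → ∃ s', Inv (k + 1) s' ∧ Exec inp m P (mem s) (mem s') N)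
    (k : ℕ) (hk : k ≤ n) (s : S) (hs : Inv k s) :
    ∃ s', Inv n s' ∧ Exec inp m (.loop e P) (mem s) (mem s') ((N + 1) * (n - k) + 1) := by
  induction h : n - k generalizing k s with
  | zero =>
    obtain rfl : k = n := by omega
    exact ⟨s, hs, (loop_end (hfit _ _ hs) (by rw [he k s hs hk, h])).mono (by omega)⟩
  | succ l ih =>
    obtain ⟨s1, hs1, h1⟩ := hP k (by omega) s hs
    obtain ⟨s2, hs2, h2⟩ := ih (k + 1) (by omega) s1 hs1 (by omega)
    refine ⟨s2, hs2, (loop_step (hfit _ _ hs) (by rw [he k s hs hk]; omega) h1 h2).mono ?_⟩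
    rw [Nat.mul_succ]; omega

end Exec

/-! ### Runs with outputs -/

/-- A configuration together with the time, the time of the last output (or `0`), and the list
of the outputs. -/
structure Trace : Type where
  cfg : Config
  time : ℕ
  last : ℕ
  out : List (List ℕ)

/-- One step of a trace. -/
def Trace.next (inp : List ℕ) (s : Trace) : Trace :=
  ⟨step inp s.cfg, s.time + 1, if (emitted inp s.cfg).isSome then s.time + 1 else s.last,
    s.out ++ (emitted inp s.cfg).toList⟩

/-- `Reach inp m d s s'` says that `s` leads to `s'`, within space `m` and with delay at most
`d`. -/
inductive Reach (inp : List ℕ) (m d : ℕ) : Trace → Trace → Prop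
  | refl (s : Trace) : Reach inp m d s s
  | head {s s' : Trace} (h1 : s.cfg.todo ≠ []) (h2 : Fits m s.cfg.mem)
      (h3 : (emitted inp s.cfg).isSome → s.time + 1 ≤ s.last + d)
      (h4 : Reach inp m d (s.next inp) s') : Reach inp m d s s'

variable {d : ℕ}

theorem Reach.trans {s s' s'' : Trace} (h : Reach inp m d s s') (h' : Reach inp m d s' s'') :
    Reach inp m d s s'' := by
  induction h with
  | refl s => exact h'
  | head h1 h2 h3 _ ih => exact .head h1 h2 h3 (ih h')

theorem Silent.reach {c c' : Config} {k : ℕ} (h : Silent inp m c k c') (t l : ℕ)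
    (o : List (List ℕ)) : Reach inp m d ⟨c, t, l, o⟩ ⟨c', t + k, l, o⟩ := by
  induction h generalizing t with
  | refl c => exact .refl _
  | head h1 h2 h3 _ ih =>
    refine .head h1 h2 (by simp [h3]) ?_
    simp only [Trace.next, h3]
    simpa [Nat.add_assoc, Nat.add_comm, Nat.add_left_comm] using ih (t + 1)

theorem Reach.output {a l : Expr} {K : List Program} {σ : Memory} {t la : ℕ}
    {o : List (List ℕ)} (h : Fits m σ) (ht : t + 1 ≤ la + d) :
    Reach inp m d ⟨⟨.output a l :: K, σ⟩, t, la, o⟩ ⟨⟨K, σ⟩, t + 1, t + 1,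
      o ++ [(List.range (l.eval inp σ)).map fun i => σ (a.eval inp σ + i)]⟩ :=
  .head (by simp) h (fun _ => ht) (.refl _)

/-- The trace agrees with the run of `P`. -/
structure Trace.Good (inp : List ℕ) (m d : ℕ) (P : Program) (s : Trace) : Prop where
  cfg : s.cfg = run P inp s.time
  out : s.out = outputs P inp s.time
  todo : ∀ i < s.time, (run P inp i).todo ≠ []
  fits : ∀ i < s.time, Fits m (run P inp i).mem
  chain : List.IsChain (fun a b => b ≤ a + d) (0 :: outputTimes P inp s.time)
  last : (0 :: outputTimes P inp s.time).getLast (by simp) = s.last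

theorem run_succ (P : Program) (inp : List ℕ) (i : ℕ) :
    run P inp (i + 1) = step inp (run P inp i) := by
  simp only [run, Function.iterate_succ_apply']

theorem isChain_append_singleton {α : Type*} {r : α → α → Prop} {a b : α} {l : List α}
    (h : List.IsChain r (a :: l)) (hb : r ((a :: l).getLast (by simp)) b) :
    List.IsChain r (a :: (l ++ [b])) := by
  rw [← List.cons_append, List.isChain_append]
  refine ⟨h, by simp, fun x hx y hy => ?_⟩
  rw [List.getLast?_eq_getLast_of_ne_nil (by simp)] at hx
  simp at hx hy
  subst hx hy
  exact hb

theorem Trace.Good.next {P : Program} {s : Trace} (hs : s.Good inp m d P)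
    (h1 : s.cfg.todo ≠ []) (h2 : Fits m s.cfg.mem)
    (h3 : (emitted inp s.cfg).isSome → s.time + 1 ≤ s.last + d) :
    (s.next inp).Good inp m d P := by
  have hc := hs.cfg
  have ht : outputTimes P inp (s.time + 1) = outputTimes P inp s.time ++
      if (emitted inp s.cfg).isSome then [s.time + 1] else [] := by
    rw [outputTimes, List.range_succ, List.filter_append, List.map_append, ← outputTimes, hc]
    congr 1
    by_cases h : (emitted inp (run P inp s.time)).isSome <;> simp [h]
  refine ⟨?_, ?_, ?_, ?_, ?_, ?_⟩
  · simp only [Trace.next, run_succ, hc]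
  · simp only [Trace.next]
    rw [hs.out, outputs, outputs, List.range_succ, List.filterMap_append]
    congr 1
    cases h : emitted inp s.cfg <;> simp [← hc, h]
  · intro i hi
    rcases Nat.lt_succ_iff_lt_or_eq.1 hi with h | h
    · exact hs.todo i h
    · rw [h, ← hc]; exact h1
  · intro i hi
    rcases Nat.lt_succ_iff_lt_or_eq.1 hi with h | h
    · exact hs.fits i h
    · rw [h, ← hc]; exact h2
  · simp only [Trace.next, ht]
    by_cases h : (emitted inp s.cfg).isSome
    · simp only [h, if_true]
      exact isChain_append_singleton hs.chain (by rw [hs.last]; exact h3 h)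
    · simpa [h] using hs.chain
  · simp only [Trace.next, ht]
    by_cases h : (emitted inp s.cfg).isSome
    · simp [h]
    · simpa [h] using hs.last

theorem Reach.good {P : Program} {s s' : Trace} (h : Reach inp m d s s')
    (hs : s.Good inp m d P) : s'.Good inp m d P := by
  induction h with
  | refl s => exact hs
  | head h1 h2 h3 _ ih => exact ih (hs.next h1 h2 h3)

/-- The initial trace is `Good`, and steps preserve this, so the time and outputs recorded by the
trace are those of the actual run. The bound `hT` covers the last gap of the delay, from the final
output to the halt. -/
theorem Reach.enumerates {P : Program} {S : Set (List ℕ)} {σ : Memory} {T l : ℕ}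
    {o : List (List ℕ)} (h : Reach inp m d ⟨⟨[P], fun _ => 0⟩, 0, 0, []⟩ ⟨⟨[], σ⟩, T, l, o⟩)
    (hσ : Fits m σ) (hT : T ≤ l + d) (hnd : o.Nodup) (ho : ∀ w, w ∈ o ↔ w ∈ S) :
    Enumerates P inp S T d m := by
  have hg := h.good (P := P) ⟨rfl, rfl, by simp, by simp, by simp [outputTimes],
    by simp [outputTimes]⟩
  have hc : (⟨[], σ⟩ : Config) = run P inp T := hg.cfg
  have hout : o = outputs P inp T := hg.out
  refine ⟨⟨by rw [← hc], hg.todo⟩, hout ▸ hnd, hout ▸ ho, ?_, ?_⟩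
  · exact isChain_append_singleton hg.chain (by rw [hg.last]; exact hT)
  · intro i hi a ha
    rcases hi.lt_or_eq with h | h
    · exact hg.fits i h a ha
    · subst h
      rw [← hc] at ha ⊢
      exact hσ a ha

end RAM

/-! ### Minimal perfect Roman dominating functions and private neighbours -/

namespace PrivateNeighbors

open Finset

variable {V : Type*} [Fintype V] [DecidableEq V] (G : SimpleGraph V) [DecidableRel G.Adj]

/-- The least perfect Roman dominating function with value `2` on the set `A` only. -/
def romanOf (A : Finset V) (v : V) : Fin 3 :=
  if v ∈ A then 2 else if #(G.neighborFinset v ∩ A) = 1 then 0 else 1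

theorem romanOf_eq_two {A : Finset V} {v : V} : romanOf G A v = 2 ↔ v ∈ A := by
  unfold romanOf
  split_ifs <;> simp_all

theorem romanOf_eq_zero {A : Finset V} {v : V} :
    romanOf G A v = 0 ↔ v ∉ A ∧ #(G.neighborFinset v ∩ A) = 1 := by
  unfold romanOf
  split_ifs <;> simp_all

theorem card_inter_eq_one {A : Finset V} {v : V} :
    #(G.neighborFinset v ∩ A) = 1 ↔ ∃! w, G.Adj v w ∧ w ∈ A := by
  rw [card_eq_one, ExistsUnique]
  simp only [Finset.ext_iff, mem_inter, SimpleGraph.mem_neighborFinset, mem_singleton]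
  refine exists_congr fun w => ⟨fun h => ⟨(h w).2 rfl, fun y hy => (h y).1 hy⟩,
    fun h y => ⟨h.2 y, ?_⟩⟩
  rintro rfl
  exact h.1

theorem isPerfect_iff {f : V → Fin 3} : IsPerfectRomanDominating G f ↔
    ∀ v, f v = 0 → #(G.neighborFinset v ∩ univ.filter (f · = 2)) = 1 := by
  simp only [card_inter_eq_one, mem_filter, mem_univ, true_and]
  exact ⟨fun h => h.2, fun h => ⟨fun v hv => (h v hv).exists, h⟩⟩

theorem filter_romanOf (A : Finset V) : univ.filter (romanOf G A · = 2) = A := by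
  ext v; simp [romanOf_eq_two]

theorem isPerfect_romanOf (A : Finset V) : IsPerfectRomanDominating G (romanOf G A) := by
  rw [isPerfect_iff, filter_romanOf]
  exact fun v hv => ((romanOf_eq_zero G).1 hv).2

theorem romanOf_le {A : Finset V} {f : V → Fin 3} (h2 : ∀ v ∈ A, f v = 2)
    (h0 : ∀ v ∉ A, f v = 0 → #(G.neighborFinset v ∩ A) = 1) : romanOf G A ≤ f := by
  intro v
  unfold romanOf
  split_ifs with h h'
  · rw [h2 v h]
  · exact Fin.zero_le _
  · have := mt (h0 v h) h'
    exact Fin.one_le_of_ne_zero this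

/-- If some `a` had no private neighbour, no vertex of value 0 would be adjacent to `a`, so `romanOf
G (A.erase a)` would lie below `f` and contradict minimality. Conversely, below `romanOf G A` a
private neighbour keeps the value 0 and its only possible 2-neighbour is its owner; so all of `A`
keeps the value 2. -/
theorem isMinimal_iff {f : V → Fin 3} : IsMinimalPerfectRomanDominating G f ↔
    ∃ A, HasPrivate G univ A ∧ f = romanOf G A := by
  constructor
  · rintro ⟨hf, hmin⟩
    rw [isPerfect_iff] at hf
    set A := univ.filter (f · = 2) with hA
    have hle : romanOf G A ≤ f := romanOf_le G (fun v hv => by simpa [hA] using hv)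
      fun v _ hv => hf v hv
    have heq : f = romanOf G A := le_antisymm (hmin (isPerfect_romanOf G A) hle) hle
    refine ⟨A, fun a ha => ?_, heq⟩
    by_contra hcon
    push Not at hcon
    have hle2 : romanOf G (A.erase a) ≤ f := by
      refine romanOf_le G (fun v hv => ?_) fun v hv hv0 => ?_
      · simpa [hA] using mem_of_mem_erase hv
      · have h1 := hf v hv0
        have hvA : v ∉ A := by simp [hA, hv0]
        rw [inter_erase, erase_eq_of_notMem, h1]
        intro hav
        rw [mem_inter, SimpleGraph.mem_neighborFinset] at hav
        obtain ⟨b, hb, hbv, hba⟩ := hcon v (mem_univ v) hvA hav.1.symm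
        obtain ⟨w, -, hw⟩ := (card_inter_eq_one G).1 h1
        exact hba ((hw b ⟨hbv.symm, hb⟩).trans (hw a hav).symm)
    have h3 := hmin (isPerfect_romanOf G _) hle2 a
    have h4 : f a = 2 := by simpa [hA] using ha
    have h5 : romanOf G (A.erase a) a ≠ 2 := by simp [romanOf_eq_two]
    rw [h4] at h3
    exact h5 (le_antisymm (Fin.le_last _) h3)
  · rintro ⟨A, hA, rfl⟩
    refine ⟨isPerfect_romanOf G A, fun g hg hle => ?_⟩
    rw [isPerfect_iff] at hg
    have hsub : univ.filter (g · = 2) ⊆ A := fun v hv => by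
      have h1 := hle v
      rw [(mem_filter.1 hv).2] at h1
      exact (romanOf_eq_two G).1 (le_antisymm (Fin.le_last _) h1)
    have hsup : A ⊆ univ.filter (g · = 2) := fun a ha => by
      obtain ⟨p, -, hpA, hap, hu⟩ := hA a ha
      have h0 : romanOf G A p = 0 := (romanOf_eq_zero G).2 ⟨hpA, (card_inter_eq_one G).2
        ⟨a, ⟨hap.symm, ha⟩, fun y hy => hu y hy.2 hy.1.symm⟩⟩
      have hg0 : g p = 0 := le_antisymm (h0 ▸ hle p) (Fin.zero_le _)
      obtain ⟨w, hw, -⟩ := (card_inter_eq_one G).1 (hg p hg0)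
      rw [← hu w (hsub hw.2) hw.1.symm]
      exact hw.2
    have heq := subset_antisymm hsub hsup
    exact romanOf_le G (fun v hv => (mem_filter.1 (hsup hv)).2) fun v _ hv => heq ▸ hg v hv

/-- A vertex of value 0 has exactly one neighbour in `A`, so it is private for that neighbour. The
program can therefore test a set by looking for zeros in the vector. -/
theorem hasPrivate_iff {A : Finset V} :
    HasPrivate G univ A ↔ ∀ a ∈ A, ∃ p, romanOf G A p = 0 ∧ G.Adj a p := by
  refine forall₂_congr fun a ha => ?_
  simp only [romanOf_eq_zero, card_inter_eq_one, mem_univ, true_and]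
  constructor
  · rintro ⟨p, hp, hap, hu⟩
    exact ⟨p, ⟨hp, a, ⟨hap.symm, ha⟩, fun y hy => hu y hy.2 hy.1.symm⟩, hap⟩
  · rintro ⟨p, ⟨hp, w, -, hw⟩, hap⟩
    exact ⟨p, hp, hap, fun b hb hbp =>
      (hw b ⟨hbp.symm, hb⟩).trans (hw a ⟨hap.symm, ha⟩).symm⟩

/-! ### The search tree -/

section Search

variable {n : ℕ} (G : SimpleGraph (Fin n)) [DecidableRel G.Adj]

/-- The sets all of whose members have a private neighbour that arise from `A` by adding at least
one vertex, each of them at least `j`, in the order of a depth-first search. -/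
def search (A : Finset (Fin n)) (j : ℕ) : List (Finset (Fin n)) :=
  if h : j < n then
    (if HasPrivate G univ (insert ⟨j, h⟩ A) then
      insert ⟨j, h⟩ A :: search (insert ⟨j, h⟩ A) (j + 1) else []) ++ search A (j + 1)
  else []
  termination_by n - j

theorem search_of_le (A : Finset (Fin n)) {j : ℕ} (h : n ≤ j) : search G A j = [] := by
  rw [search, dif_neg (by omega)]

theorem mem_search {A B : Finset (Fin n)} {j : ℕ} (hA : ∀ v ∈ A, (v : ℕ) < j) :
    B ∈ search G A j ↔
      HasPrivate G univ B ∧ A ⊆ B ∧ B ≠ A ∧ ∀ v ∈ B, v ∉ A → j ≤ v := by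
  induction h : n - j generalizing A j with
  | zero =>
    rw [search_of_le G A (by omega)]
    simp only [List.not_mem_nil, false_iff]
    rintro ⟨-, h2, h3, h4⟩
    refine h3 (subset_antisymm (fun v hv => ?_) h2)
    by_contra hvA
    have := h4 v hv hvA
    omega
  | succ k ih =>
    have hj : j < n := by omega
    have hwA : (⟨j, hj⟩ : Fin n) ∉ A := fun h => lt_irrefl _ (hA _ h)
    have ih1 := ih (A := insert ⟨j, hj⟩ A) (j := j + 1) (fun v hv => by
      rcases mem_insert.1 hv with rfl | hv
      · exact Nat.lt_succ_self _
      · exact (hA v hv).trans (Nat.lt_succ_self _)) (by omega)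
    have ih2 := ih (A := A) (j := j + 1) (fun v hv => (hA v hv).trans (Nat.lt_succ_self _))
      (by omega)
    have hlt : ∀ v : Fin n, v ≠ ⟨j, hj⟩ → j ≤ v → j + 1 ≤ v := fun v hv hjv =>
      Nat.succ_le_of_lt (lt_of_le_of_ne hjv fun h => hv (Fin.ext h.symm))
    rw [search, dif_pos hj, List.mem_append, ih2]
    by_cases hwB : (⟨j, hj⟩ : Fin n) ∈ B
    · have hno : ¬ ∀ v ∈ B, v ∉ A → j + 1 ≤ (v : ℕ) := fun h => by
        simpa using h _ hwB hwA
      simp only [hno, and_false, or_false]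
      constructor
      · intro h1
        split_ifs at h1 with hv
        swap
        · simp at h1
        rw [List.mem_cons, ih1] at h1
        rcases h1 with rfl | ⟨h1, h2, h3, h4⟩
        · refine ⟨hv, subset_insert _ _, fun h => hwA (h ▸ mem_insert_self _ _), fun v hv hvA => ?_⟩
          rcases mem_insert.1 hv with rfl | hv
          · exact le_rfl
          · exact absurd hv hvA
        · refine ⟨h1, (subset_insert _ _).trans h2, fun h => hwA (h ▸ hwB), fun v hv hvA => ?_⟩
          by_cases hvw : v = ⟨j, hj⟩
          · rw [hvw]
          · exact (Nat.le_succ j).trans (h4 v hv (by simp [hvw, hvA]))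
      · rintro ⟨h1, h2, -, h4⟩
        have hsub := insert_subset hwB h2
        -- Pruning loses nothing: a solution `B` above the extended set makes the extended set a
        -- solution.
        rw [if_pos (h1.subset hsub), List.mem_cons, ih1]
        by_cases hB : B = insert ⟨j, hj⟩ A
        · exact Or.inl hB
        · refine Or.inr ⟨h1, hsub, hB, fun v hv hvA => ?_⟩
          rw [mem_insert, not_or] at hvA
          exact hlt v hvA.1 (h4 v hv hvA.2)
    · have hno : B ∉ (if HasPrivate G univ (insert ⟨j, hj⟩ A) then
          insert ⟨j, hj⟩ A :: search G (insert ⟨j, hj⟩ A) (j + 1) else []) := by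
        split_ifs
        · rw [List.mem_cons, ih1, not_or]
          exact ⟨fun h => hwB (h ▸ mem_insert_self _ _),
            fun h => hwB (h.2.1 (mem_insert_self _ _))⟩
        · simp
      simp only [hno, false_or]
      refine and_congr_right fun _ => and_congr_right fun _ => and_congr_right fun _ =>
        forall₃_congr fun v hv _ => ⟨fun h => (Nat.le_succ j).trans h, hlt v ?_⟩
      rintro rfl
      exact hwB hv

theorem nodup_search {A : Finset (Fin n)} {j : ℕ} (hA : ∀ v ∈ A, (v : ℕ) < j) :
    (search G A j).Nodup := by
  induction h : n - j generalizing A j with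
  | zero =>
    rw [search_of_le G A (by omega)]
    exact List.nodup_nil
  | succ k ih =>
    have hj : j < n := by omega
    have hwA : (⟨j, hj⟩ : Fin n) ∉ A := fun h => lt_irrefl _ (hA _ h)
    have hA1 : ∀ v ∈ insert ⟨j, hj⟩ A, (v : ℕ) < j + 1 := fun v hv => by
      rcases mem_insert.1 hv with rfl | hv
      · exact Nat.lt_succ_self _
      · exact (hA v hv).trans (Nat.lt_succ_self _)
    have hA2 : ∀ v ∈ A, (v : ℕ) < j + 1 := fun v hv => (hA v hv).trans (Nat.lt_succ_self _)
    have h2 := ih hA2 (by omega)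
    rw [search, dif_pos hj]
    split_ifs
    swap
    · simpa using h2
    refine List.Nodup.append (List.nodup_cons.2 ⟨?_, ih hA1 (by omega)⟩) h2 ?_
    · rw [mem_search G hA1]
      exact fun h => h.2.2.1 rfl
    · intro B hB hB2
      rw [mem_search G hA2] at hB2
      have hwB : (⟨j, hj⟩ : Fin n) ∈ B := by
        rcases List.mem_cons.1 hB with rfl | hB
        · exact mem_insert_self _ _
        · exact ((mem_search G hA1).1 hB).2.1 (mem_insert_self _ _)
      simpa using hB2.2.2.2 _ hwB hwA

theorem mem_cons_search {B : Finset (Fin n)} :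
    B ∈ ∅ :: search G ∅ 0 ↔ HasPrivate G univ B := by
  rw [List.mem_cons, mem_search G (by simp)]
  constructor
  · rintro (rfl | h)
    · simp [HasPrivate]
    · exact h.1
  · intro h
    by_cases hB : B = ∅
    · exact Or.inl hB
    · exact Or.inr ⟨h, empty_subset _, hB, fun _ _ _ => Nat.zero_le _⟩

theorem nodup_cons_search : (∅ :: search G ∅ 0).Nodup := by
  refine List.nodup_cons.2 ⟨?_, nodup_search G (by simp)⟩
  rw [mem_search G (by simp)]
  exact fun h => h.2.2.1 rfl

/-- The listed sets are distinct and are exactly those counted by `count G univ univ`; the summand 1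
is the empty set, which `search` omits. -/
theorem length_search_le : ((search G ∅ 0).length + 1 : ℝ) ≤ 1.9332 ^ n := by
  have h : (search G ∅ 0).length + 1 = count G univ univ := by
    rw [← List.length_cons (a := ∅), ← List.toFinset_card_of_nodup (nodup_cons_search G), count]
    congr 1
    ext B
    rw [List.mem_toFinset, mem_cons_search]
    simp
  have := count_univ_le G
  rw [← h, Fintype.card_fin] at this
  exact_mod_cast this

/-- The word of the least perfect Roman dominating function with value `2` on `A` only. -/
def wordOf (A : Finset (Fin n)) : List ℕ := functionWord (romanOf G A)

theorem wordOf_injective : Function.Injective (wordOf G) := by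
  intro A B h
  have h1 : (fun v => (romanOf G A v : ℕ)) = fun v => (romanOf G B v : ℕ) :=
    List.ofFn_injective h
  ext v
  rw [← romanOf_eq_two G, ← romanOf_eq_two G, Fin.ext (congrFun h1 v)]

theorem mem_words_iff (w : List ℕ) : w ∈ (∅ :: search G ∅ 0).map (wordOf G) ↔
    ∃ f : Fin n → Fin 3, IsMinimalPerfectRomanDominating G f ∧ w = functionWord f := by
  simp only [List.mem_map, mem_cons_search, isMinimal_iff]
  constructor
  · rintro ⟨A, hA, rfl⟩
    exact ⟨_, ⟨A, hA, rfl⟩, rfl⟩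
  · rintro ⟨_, ⟨A, hA, rfl⟩, rfl⟩
    exact ⟨A, hA, rfl⟩

end Search

end PrivateNeighbors

/-! ### The program -/

namespace RAM

open PrivateNeighbors

/-- The contents of the registers, with names: seven variables, followed by a vector. -/
structure St : Type where
  j : ℕ
  done : ℕ
  p : ℕ
  q : ℕ
  acc : ℕ
  row : ℕ
  bad : ℕ
  F : ℕ → ℕ

/-- The registers as a memory. -/
def St.mem (s : St) : Memory
  | 0 => s.j
  | 1 => s.done
  | 2 => s.p
  | 3 => s.q
  | 4 => s.acc
  | 5 => s.row
  | 6 => s.bad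
  | k + 7 => s.F k

namespace St

variable (s : St) (x k : ℕ)

theorem mem_zero : s.mem 0 = s.j := rfl
theorem mem_one : s.mem 1 = s.done := rfl
theorem mem_two : s.mem 2 = s.p := rfl
theorem mem_three : s.mem 3 = s.q := rfl
theorem mem_four : s.mem 4 = s.acc := rfl
theorem mem_five : s.mem 5 = s.row := rfl
theorem mem_six : s.mem 6 = s.bad := rfl
theorem mem_add : s.mem (7 + k) = s.F k := by rw [Nat.add_comm]; rfl

theorem update_zero : Function.update s.mem 0 x = {s with j := x}.mem := by
  funext i; rcases i with _ | _ | _ | _ | _ | _ | _ | i <;> simp [mem]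
theorem update_one : Function.update s.mem 1 x = {s with done := x}.mem := by
  funext i; rcases i with _ | _ | _ | _ | _ | _ | _ | i <;> simp [mem]
theorem update_two : Function.update s.mem 2 x = {s with p := x}.mem := by
  funext i; rcases i with _ | _ | _ | _ | _ | _ | _ | i <;> simp [mem]
theorem update_three : Function.update s.mem 3 x = {s with q := x}.mem := by
  funext i; rcases i with _ | _ | _ | _ | _ | _ | _ | i <;> simp [mem]
theorem update_four : Function.update s.mem 4 x = {s with acc := x}.mem := by
  funext i; rcases i with _ | _ | _ | _ | _ | _ | _ | i <;> simp [mem]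
theorem update_five : Function.update s.mem 5 x = {s with row := x}.mem := by
  funext i; rcases i with _ | _ | _ | _ | _ | _ | _ | i <;> simp [mem]
theorem update_six : Function.update s.mem 6 x = {s with bad := x}.mem := by
  funext i; rcases i with _ | _ | _ | _ | _ | _ | _ | i <;> simp [mem]
theorem update_add : Function.update s.mem (7 + k) x =
    {s with F := Function.update s.F k x}.mem := by
  rw [Nat.add_comm]
  funext i; rcases i with _ | _ | _ | _ | _ | _ | _ | i <;> simp [Function.update_apply, mem]

/-- Bounds for the contents of the registers. -/
structure Bdd (n : ℕ) (s : St) : Prop where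
  j : s.j ≤ n
  done : s.done ≤ 1
  p : s.p ≤ n
  q : s.q ≤ n
  acc : s.acc ≤ n
  row : s.row ≤ n * n + 1
  bad : s.bad ≤ n
  F : ∀ k, s.F k ≤ 2
  F_of_le : ∀ k, n ≤ k → s.F k = 0

variable {s}

theorem Bdd.fits {n : ℕ} (h : s.Bdd n) : Fits (n * n + n + 10) s.mem := by
  have key : ∀ y, y ≤ n * n + n + 2 → y < 2 ^ (n * n + n + 10) := fun y hy =>
    (hy.trans (by omega)).trans_lt Nat.lt_two_pow_self
  have hF := h.F
  rcases h with ⟨h0, h1, h2, h3, h4, h5, h6, -, h8⟩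
  intro i hi
  rcases i with _ | _ | _ | _ | _ | _ | _ | i <;> simp only [mem] at hi ⊢
  iterate 7 exact ⟨by omega, key _ (by omega)⟩
  have : i < n := by
    by_contra hin
    exact hi (h8 i (by omega))
  have := hF i
  exact ⟨by omega, key _ (by omega)⟩

end St

/-- The order of the graph. -/
abbrev ordE : Expr := .input (.const 0)

/-- A variable. -/
abbrev varE (i : ℕ) : Expr := .reg (.const i)

/-- The address of an entry of the vector. -/
abbrev adrE (i : ℕ) : Expr := .add (.const 7) (varE i)

/-- An entry of the vector. -/
abbrev vecE (i : ℕ) : Expr := .reg (adrE i)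

/-- Adds up the values of an expression for `q = 0, …, n - 1`. -/
def sumLoop (e : Expr) : Program :=
  .seq (.store (.const 4) (.const 0)) (.seq (.store (.const 3) (.const 0))
    (.loop (.sub ordE (varE 3)) (.seq (.store (.const 4) (.add (varE 4) e))
      (.store (.const 3) (.add (varE 3) (.const 1))))))

/-- Executes a program for `p = 0, …, n - 1`, and the number `1 + p * n` in another variable. -/
def rowLoop (P : Program) : Program :=
  .seq (.store (.const 2) (.const 0)) (.seq (.store (.const 5) (.const 1))
    (.loop (.sub ordE (varE 2)) (.seq P (.seq (.store (.const 5) (.add (varE 5) ordE))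
      (.store (.const 2) (.add (varE 2) (.const 1)))))))

/-- Replaces the entries other than `2` of the vector according to the number of neighbours with
entry `2`. -/
def fillProgram : Program :=
  rowLoop (.seq
    -- For bits `x` and `y`, `x + y - 1` is their conjunction; an entry minus 1 is 1 exactly for the
    -- entry 2.
    (sumLoop (.sub (.add (.input (.add (varE 5) (varE 3))) (.sub (vecE 3) (.const 1))) (.const 1)))
    (.cond (.sub (vecE 2) (.const 1)) .skip
      -- For a count `c`, `(1 - c) + (c - 1)` vanishes only at `c = 1`; the two outer subtractions
      -- turn it into a bit.
      (.store (adrE 2) (.sub (.const 1) (.sub (.const 1)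
        (.add (.sub (.const 1) (varE 4)) (.sub (varE 4) (.const 1))))))))

/-- Counts the vertices with entry `2` without a neighbour with entry `0`. -/
def testProgram : Program :=
  .seq (.store (.const 6) (.const 0)) (rowLoop (.seq
    (sumLoop (.sub (.add (.sub (.const 1) (vecE 3)) (.input (.add (varE 5) (varE 3)))) (.const 1)))
    (.store (.const 6) (.add (varE 6) (.sub (.sub (vecE 2) (.const 1)) (varE 4))))))

/-- Tries to add the vertex `j`, and proceeds to the next one. -/
def tryProgram : Program :=
  .seq (.store (adrE 0) (.const 2)) (.seq fillProgram (.seq testProgram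
    (.seq (.cond (varE 6) (.store (adrE 0) (.const 0)) (.output (.const 7) ordE))
      (.store (.const 0) (.add (varE 0) (.const 1))))))

/-- Removes the last vertex, and proceeds to the next one. -/
def popProgram : Program :=
  -- The guard is the conjunction of "entry `j - 1` is not 2" and "`j` is not 0".
  .seq (.loop (.sub (.add (.sub (.const 1) (.sub (.reg (.add (.const 7) (.sub (varE 0) (.const 1))))
        (.const 1))) (.sub (.const 1) (.sub (.const 1) (varE 0)))) (.const 1))
      (.store (.const 0) (.sub (varE 0) (.const 1))))
    (.cond (varE 0) (.store (.add (.const 7) (.sub (varE 0) (.const 1))) (.const 0))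
      (.store (.const 1) (.const 1)))

/-- The main loop. -/
def mainLoop : Program :=
  .loop (.sub (.const 1) (varE 1)) (.cond (.sub ordE (varE 0)) tryProgram popProgram)

/-- The enumeration program. -/
def enumProgram : Program := .seq fillProgram (.seq (.output (.const 7) ordE) mainLoop)

/-! ### Effect and duration of the inner loops. -/

section Loops

variable {inp : List ℕ} {n : ℕ}

theorem exec_sumLoop (hn : inp.getD 0 0 = n) {s : St} (hs : s.Bdd n) {e : Expr} {g : ℕ → ℕ}
    (hg : ∀ q < n, g q ≤ 1)
    (he : ∀ q < n, ∀ a, e.eval inp {s with q := q, acc := a}.mem = g q) :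
    Exec inp (n * n + n + 10) (sumLoop e) s.mem
      {s with q := n, acc := ∑ q ∈ Finset.range n, g q}.mem (4 * n + 5) := by
  have hsum : ∀ k ≤ n, ∑ q ∈ Finset.range k, g q ≤ k := fun k hk => by
    have := Finset.sum_le_card_nsmul (Finset.range k) g 1
      fun q hq => hg q ((Finset.mem_range.1 hq).trans_le hk)
    simpa using this
  have hb : ∀ q ≤ n, ∀ a ≤ n, St.Bdd n {s with q := q, acc := a} := fun q hq a ha =>
    { hs with q := hq, acc := ha }
  have hb0 : St.Bdd n {s with acc := 0} := { hs with acc := Nat.zero_le _ }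
  obtain ⟨s', ⟨-, rfl⟩, h⟩ := Exec.counting_loop (inp := inp) (m := n * n + n + 10)
    (e := .sub ordE (varE 3)) (P := .seq (.store (.const 4) (.add (varE 4) e))
      (.store (.const 3) (.add (varE 3) (.const 1)))) (N := 3) (mem := St.mem) (n := n)
    (Inv := fun k s' => k ≤ n ∧ s' = {s with q := k, acc := ∑ q ∈ Finset.range k, g q})
    (by rintro k s' ⟨hk, rfl⟩; exact (hb k hk _ ((hsum k hk).trans hk)).fits)
    (by rintro k s' ⟨hk, rfl⟩ -; simp only [Expr.eval, St.mem_three, hn])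
    (by
      rintro k hk s' ⟨-, rfl⟩
      refine ⟨_, ⟨hk, rfl⟩, Exec.seq (hb k hk.le _ ((hsum k hk.le).trans hk.le)).fits
        (Exec.store (hb k hk.le _ ((hsum k hk.le).trans hk.le)).fits ?_)
        (Exec.store (σ := St.mem {s with q := k, acc := ∑ q ∈ Finset.range (k + 1), g q})
          (hb k hk.le _ ((hsum _ hk).trans hk)).fits ?_)⟩
      · simp only [Expr.eval, St.mem_four, he k hk, St.update_four, Finset.sum_range_succ]
      · simp only [Expr.eval, St.mem_three, St.update_three])
    0 (Nat.zero_le _) {s with q := 0, acc := 0} ⟨Nat.zero_le _, by simp⟩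
  refine (Exec.seq hs.fits (Exec.store hs.fits (σ' := St.mem {s with acc := 0}) ?_)
    (Exec.seq hb0.fits (Exec.store hb0.fits (σ' := St.mem {s with q := 0, acc := 0}) ?_) h)).mono
      (by omega)
  · simp only [Expr.eval, St.update_four]
  · simp only [Expr.eval, St.update_three]

/-- By `hi` the invariant does not depend on the registers `p` and `row`, so it survives the
bookkeeping of the loop. -/
theorem exec_rowLoop (hn : inp.getD 0 0 = n) {P : Program} {N : ℕ} {Inv : ℕ → St → Prop}
    (hb : ∀ k s, Inv k s → s.Bdd n)
    (hi : ∀ k s, Inv k s → ∀ p ≤ n, ∀ r ≤ n * n + 1, Inv k {s with p := p, row := r})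
    (hP : ∀ k < n, ∀ s, Inv k s → s.p = k → s.row = 1 + k * n →
      ∃ s', (Inv (k + 1) s' ∧ s'.p = k ∧ s'.row = 1 + k * n) ∧
        Exec inp (n * n + n + 10) P s.mem s'.mem N) (s : St) (hs : Inv 0 s) :
    ∃ s', Inv n s' ∧ Exec inp (n * n + n + 10) (rowLoop P) s.mem s'.mem ((N + 5) * n + 5) := by
  have hr : ∀ k ≤ n, 1 + k * n ≤ n * n + 1 := fun k hk => by nlinarith
  have hb0 := hb 0 _ (hi 0 s hs 0 (Nat.zero_le _) s.row (hb 0 s hs).row)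
  obtain ⟨s', ⟨-, hs', -, -⟩, h⟩ := Exec.counting_loop (inp := inp) (m := n * n + n + 10)
    (e := .sub ordE (varE 2)) (P := .seq P (.seq (.store (.const 5) (.add (varE 5) ordE))
      (.store (.const 2) (.add (varE 2) (.const 1))))) (N := N + 4) (mem := St.mem) (n := n)
    (Inv := fun k s' => k ≤ n ∧ Inv k s' ∧ s'.p = k ∧ s'.row = 1 + k * n)
    (fun k s' h => (hb k s' h.2.1).fits)
    (fun k s' h _ => by simp only [Expr.eval, St.mem_two, hn, h.2.2.1])
    (by
      rintro k hk s1 ⟨-, h1, h2, h3⟩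
      obtain ⟨s2, ⟨h4, h5, h6⟩, h7⟩ := hP k hk s1 h1 h2 h3
      have h8 := hi (k + 1) s2 h4 k hk.le (1 + (k + 1) * n) (hr _ hk)
      refine ⟨{s2 with p := k + 1, row := 1 + (k + 1) * n}, ⟨hk, hi (k + 1) s2 h4 _ hk _ (hr _ hk),
        rfl, rfl⟩, (Exec.seq (hb k s1 h1).fits h7 (Exec.seq (hb _ s2 h4).fits
          (Exec.store (hb _ s2 h4).fits (σ' := St.mem {s2 with p := k, row := 1 + (k + 1) * n}) ?_)
          (Exec.store (hb _ _ h8).fits ?_))).mono (by omega)⟩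
      · have : s2 = {s2 with p := k} := by cases s2; cases h5; rfl
        rw [this]
        simp only [Expr.eval, St.mem_five, h6, hn, St.update_five]
        rw [Nat.succ_mul, Nat.add_assoc]
      · simp only [Expr.eval, St.mem_two, St.update_two])
    0 (Nat.zero_le _) {s with p := 0, row := 1}
    ⟨Nat.zero_le _, hi 0 s hs 0 (Nat.zero_le _) 1 (by omega), rfl, by simp⟩
  refine ⟨s', hs', (Exec.seq (hb 0 s hs).fits (Exec.store (hb 0 s hs).fits
    (σ' := St.mem {s with p := 0}) ?_) (Exec.seq hb0.fits (Exec.store hb0.fits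
      (σ' := St.mem {s with p := 0, row := 1}) ?_) h)).mono (by simp only [Nat.sub_zero, Nat.add_assoc, Nat.reduceAdd]; omega)⟩
  · simp only [Expr.eval, St.update_two]
  · simp only [Expr.eval, St.update_five]

end Loops

section Graph

variable {n : ℕ} (G : SimpleGraph (Fin n)) [DecidableRel G.Adj]

theorem graphWord_zero : (graphWord G).getD 0 0 = n := rfl

theorem graphWord_adj (p q : Fin n) :
    (graphWord G).getD (1 + p * n + q) 0 = if G.Adj p q then 1 else 0 := by
  have hlt : (p : ℕ) * n + q < n * n := by
    have := p.2; have := q.2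
    nlinarith
  have h1 : 1 + (p : ℕ) * n + q = p * n + q + 1 := by ring
  have h2 : (⟨p * n + q, hlt⟩ : Fin (n * n)).divNat = p := by
    ext
    rw [Fin.coe_divNat]
    show ((p : ℕ) * n + q) / n = p
    rw [Nat.add_comm, Nat.add_mul_div_right _ _ p.pos, Nat.div_eq_of_lt q.2, Nat.zero_add]
  have h3 : (⟨p * n + q, hlt⟩ : Fin (n * n)).modNat = q := by
    ext
    rw [Fin.coe_modNat]
    show ((p : ℕ) * n + q) % n = q
    rw [Nat.add_comm, Nat.add_mul_mod_self_right, Nat.mod_eq_of_lt q.2]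
  rw [h1, graphWord, List.getD_cons_succ, List.getD_eq_getElem _ _ (by simpa using hlt),
    List.getElem_ofFn, h2, h3]

end Graph

end RAM

namespace RAM

open PrivateNeighbors Finset

theorem sum_range_eq_card {n : ℕ} {g : ℕ → ℕ} {S : Finset (Fin n)}
    (h : ∀ q : Fin n, g q = if q ∈ S then 1 else 0) : ∑ q ∈ range n, g q = #S := by
  rw [Finset.sum_range, Finset.sum_congr rfl fun q _ => h q]
  simp

section Graph

variable {n : ℕ} (G : SimpleGraph (Fin n)) [DecidableRel G.Adj]

/-- The entries `2` of the vector mark the set `A`. -/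
def St.Marks (A : Finset (Fin n)) (s : St) : Prop := ∀ v : Fin n, s.F v = 2 ↔ v ∈ A

/-- The vector is the least perfect Roman dominating function with value `2` on `A` only. -/
def St.Roman (A : Finset (Fin n)) (s : St) : Prop := ∀ v : Fin n, s.F v = romanOf G A v

variable {G} in
theorem St.Roman.marks {A : Finset (Fin n)} {s : St} (h : s.Roman G A) : s.Marks A := fun v => by
  rw [h v, ← romanOf_eq_two G]
  exact ⟨fun h => Fin.ext h, fun h => by rw [h]; rfl⟩

/-- Overwriting in place is safe: the sums only ask which entries are 2, and no entry becomes or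
ceases to be 2. For the same reason stale entries 0 and 1 do no harm, and `Marks` is enough as
hypothesis. -/
theorem exec_fillProgram (A : Finset (Fin n)) (s : St) (hs : s.Bdd n) (hA : s.Marks A) :
    ∃ s' : St, (s'.Bdd n ∧ s'.j = s.j ∧ s'.done = s.done ∧ s'.Roman G A) ∧
      Exec (graphWord G) (n * n + n + 10) fillProgram s.mem s'.mem ((4 * n + 13) * n + 5) := by
  obtain ⟨s', ⟨h1, h2, h3, h4, h5⟩, h6⟩ := exec_rowLoop (graphWord_zero G) (N := 4 * n + 8)
    (Inv := fun k s' => s'.Bdd n ∧ s'.j = s.j ∧ s'.done = s.done ∧ s'.Marks A ∧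
      ∀ v : Fin n, (v : ℕ) < k → s'.F v = romanOf G A v)
    (P := .seq
    (sumLoop (.sub (.add (.input (.add (varE 5) (varE 3))) (.sub (vecE 3) (.const 1))) (.const 1)))
    (.cond (.sub (vecE 2) (.const 1)) .skip
      (.store (adrE 2) (.sub (.const 1) (.sub (.const 1)
        (.add (.sub (.const 1) (varE 4)) (.sub (varE 4) (.const 1))))))))
    (fun k s' h => h.1)
    (fun k s' h p hp r hr => ⟨{ h.1 with p := hp, row := hr }, h.2⟩)
    (by
      rintro k hk s1 ⟨h1, h2, h3, h4, h5⟩ hp hr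
      have hsum := exec_sumLoop (graphWord_zero G) h1
        (e := .sub (.add (.input (.add (varE 5) (varE 3))) (.sub (vecE 3) (.const 1))) (.const 1))
        (g := fun q => (graphWord G).getD (1 + k * n + q) 0 + (s1.F q - 1) - 1)
        (by
          intro q hq
          have e1 := graphWord_adj G ⟨k, hk⟩ ⟨q, hq⟩
          have e2 := h1.F q
          simp only at e1
          simp only [e1]
          split_ifs <;> omega)
        (by
          intro q hq a
          simp only [Expr.eval, St.mem_five, St.mem_three, St.mem_add, hr])
      rw [sum_range_eq_card (S := G.neighborFinset ⟨k, hk⟩ ∩ A)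
        (by
          intro q
          have e1 := graphWord_adj G ⟨k, hk⟩ q
          have e2 := h1.F q
          have e3 := h4 q
          simp only at e1
          simp only [e1, mem_inter, SimpleGraph.mem_neighborFinset]
          by_cases hqA : q ∈ A
          · have := e3.2 hqA
            split_ifs <;> simp_all
          · have : s1.F q ≠ 2 := fun h => hqA (e3.1 h)
            have : s1.F q - 1 = 0 := by omega
            split_ifs <;> simp_all)] at hsum
      have hc : #(G.neighborFinset ⟨k, hk⟩ ∩ A) ≤ n :=
        (card_le_univ _).trans (by simp)
      generalize hcc : #(G.neighborFinset ⟨k, hk⟩ ∩ A) = c at hsum hc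
      have hb2 : St.Bdd n {s1 with q := n, acc := c} := { h1 with q := le_rfl, acc := hc }
      by_cases hkA : (⟨k, hk⟩ : Fin n) ∈ A
      · have hF : s1.F k = 2 := (h4 ⟨k, hk⟩).2 hkA
        refine ⟨{s1 with q := n, acc := c}, ⟨⟨hb2, h2, h3, h4, fun v hv => ?_⟩, hp, hr⟩,
          (Exec.seq h1.fits hsum (Exec.cond_true hb2.fits ?_ (Exec.skip hb2.fits))).mono
            (by omega)⟩
        · rcases Nat.lt_succ_iff_lt_or_eq.1 hv with hv | hv
          · exact h5 v hv
          · obtain rfl : v = ⟨k, hk⟩ := Fin.ext hv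
            rw [(romanOf_eq_two G).2 hkA]
            exact hF
        · simp only [Expr.eval, St.mem_two, St.mem_add, hp, hF]
          omega
      · have hF : s1.F k ≠ 2 := fun h => hkA ((h4 ⟨k, hk⟩).1 h)
        have hF1 : s1.F k - 1 = 0 := by have := h1.F k; omega
        refine ⟨{s1 with q := n, acc := c,
                         F := Function.update s1.F k (1 - (1 - ((1 - c) + (c - 1))))},
          ⟨⟨{ hb2 with F := fun i => ?_, F_of_le := fun i hi => ?_ }, h2, h3, fun v => ?_,
            fun v hv => ?_⟩, hp, hr⟩,
          (Exec.seq h1.fits hsum (Exec.cond_false hb2.fits ?_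
            (Exec.store hb2.fits ?_))).mono (by omega)⟩
        · show Function.update s1.F k _ i ≤ 2
          rw [Function.update_apply]
          split_ifs
          · omega
          · exact h1.F i
        · show Function.update s1.F k _ i = 0
          rw [Function.update_of_ne (by omega)]
          exact h1.F_of_le i hi
        · show Function.update s1.F k _ v = 2 ↔ _
          rw [Function.update_apply]
          split_ifs with hvk
          · obtain rfl : v = ⟨k, hk⟩ := Fin.ext hvk
            simp only [hkA, iff_false]
            omega
          · exact h4 v
        · show Function.update s1.F k _ v = _
          rcases Nat.lt_succ_iff_lt_or_eq.1 hv with hv | hv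
          · rw [Function.update_of_ne (by omega)]
            exact h5 v hv
          · obtain rfl : v = ⟨k, hk⟩ := Fin.ext hv
            rw [Function.update_self]
            simp only [romanOf, hkA, if_false, hcc]
            split_ifs with h1c
            · simp [h1c]
            · show _ = 1
              omega
        · simp only [Expr.eval, St.mem_two, St.mem_add, hp, hF1]
        · simp only [Expr.eval, St.mem_two, St.mem_four, St.update_add, hp])
    s ⟨hs, rfl, rfl, hA, fun v hv => absurd hv (Nat.not_lt_zero _)⟩
  exact ⟨s', ⟨h1, h2, h3, fun v => h5 v v.2⟩, h6⟩

theorem exec_testProgram (A : Finset (Fin n)) (s : St) (hs : s.Bdd n) (hA : s.Roman G A) :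
    ∃ s' : St, (s'.Bdd n ∧ s'.j = s.j ∧ s'.done = s.done ∧ s'.Roman G A ∧
      (s'.bad = 0 ↔ HasPrivate G univ A)) ∧
      Exec (graphWord G) (n * n + n + 10) testProgram s.mem s'.mem ((4 * n + 12) * n + 7) := by
  have hs0 : St.Bdd n {s with bad := 0} := { hs with bad := Nat.zero_le _ }
  obtain ⟨s', ⟨h1, h2, h3, h4, -, h5⟩, h6⟩ := exec_rowLoop (graphWord_zero G) (N := 4 * n + 7)
    (Inv := fun k s' => s'.Bdd n ∧ s'.j = s.j ∧ s'.done = s.done ∧ s'.Roman G A ∧ s'.bad ≤ k ∧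
      (s'.bad = 0 ↔ ∀ v ∈ A, (v : ℕ) < k → ∃ p, romanOf G A p = 0 ∧ G.Adj v p))
    (P := .seq
    (sumLoop (.sub (.add (.sub (.const 1) (vecE 3)) (.input (.add (varE 5) (varE 3)))) (.const 1)))
    (.store (.const 6) (.add (varE 6) (.sub (.sub (vecE 2) (.const 1)) (varE 4)))))
    (fun k s' h => h.1)
    (fun k s' h p hp r hr => ⟨{ h.1 with p := hp, row := hr }, h.2⟩)
    (by
      rintro k hk s1 ⟨h1, h2, h3, h4, h5, h5'⟩ hp hr
      have hsum := exec_sumLoop (graphWord_zero G) h1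
        (e := .sub (.add (.sub (.const 1) (vecE 3)) (.input (.add (varE 5) (varE 3)))) (.const 1))
        (g := fun q => (1 - s1.F q) + (graphWord G).getD (1 + k * n + q) 0 - 1)
        (by
          intro q hq
          have e1 := graphWord_adj G ⟨k, hk⟩ ⟨q, hq⟩
          simp only at e1
          simp only [e1]
          split_ifs <;> omega)
        (by
          intro q hq a
          simp only [Expr.eval, St.mem_five, St.mem_three, St.mem_add, hr])
      rw [sum_range_eq_card (S := {p | romanOf G A p = 0 ∧ G.Adj ⟨k, hk⟩ p})
        (by
          intro q
          have e1 := graphWord_adj G ⟨k, hk⟩ q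
          simp only at e1
          simp only [e1, h4 q, mem_filter, mem_univ, true_and]
          by_cases h0 : romanOf G A q = 0
          · simp [h0]
          · have : (romanOf G A q : ℕ) ≠ 0 := fun h => h0 (Fin.ext h)
            have : 1 - (romanOf G A q : ℕ) = 0 := by omega
            simp only [this, h0, false_and, if_false]
            split_ifs <;> rfl)] at hsum
      have hc : #{p | romanOf G A p = 0 ∧ G.Adj ⟨k, hk⟩ p} ≤ n :=
        (card_le_univ _).trans (by simp)
      have hcc : 0 < #{p | romanOf G A p = 0 ∧ G.Adj ⟨k, hk⟩ p} ↔
          ∃ p, romanOf G A p = 0 ∧ G.Adj ⟨k, hk⟩ p := by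
        rw [card_pos]
        simp [Finset.Nonempty]
      generalize #{p | romanOf G A p = 0 ∧ G.Adj ⟨k, hk⟩ p} = c at hsum hc hcc
      have hb2 : St.Bdd n {s1 with q := n, acc := c} := { h1 with q := le_rfl, acc := hc }
      have hF := h1.F k
      have hm : s1.F k = 2 ↔ (⟨k, hk⟩ : Fin n) ∈ A := h4.marks ⟨k, hk⟩
      have hle : s1.bad + (s1.F k - 1 - c) ≤ k + 1 := by omega
      refine ⟨{s1 with q := n, acc := c, bad := s1.bad + (s1.F k - 1 - c)},
        ⟨⟨{ hb2 with bad := hle.trans hk }, h2, h3, h4, hle, ?_⟩, hp, hr⟩,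
        (Exec.seq h1.fits hsum (Exec.store hb2.fits ?_)).mono (by omega)⟩
      · show s1.bad + (s1.F k - 1 - c) = 0 ↔ _
        rw [Nat.add_eq_zero_iff, h5']
        constructor
        · rintro ⟨h6, h7⟩ v hv hvk
          rcases Nat.lt_succ_iff_lt_or_eq.1 hvk with hvk | hvk
          · exact h6 v hv hvk
          · obtain rfl : v = ⟨k, hk⟩ := Fin.ext hvk
            have := hm.2 hv
            exact hcc.1 (by omega)
        · intro h6
          refine ⟨fun v hv hvk => h6 v hv (by omega), ?_⟩
          by_cases hkA : (⟨k, hk⟩ : Fin n) ∈ A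
          · have := hcc.2 (h6 _ hkA (Nat.lt_succ_self _))
            omega
          · have := mt hm.1 hkA
            omega
      · simp only [Expr.eval, St.mem_two, St.mem_four, St.mem_six, St.mem_add, St.update_six, hp])
    {s with bad := 0} ⟨hs0, rfl, rfl, hA, le_rfl, by simp⟩
  refine ⟨s', ⟨h1, h2, h3, h4, ?_⟩, (Exec.seq hs.fits (Exec.store hs.fits
    (σ' := St.mem {s with bad := 0}) ?_) h6).mono
      (by simp only [Nat.add_assoc, Nat.reduceAdd]; omega)⟩
  · rw [h5, hasPrivate_iff]
    exact forall₂_congr fun v _ => ⟨fun h => h v.2, fun h _ => h⟩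
  · simp only [Expr.eval, St.update_six]

/-! ### Rounds of the main loop: backtracking, stopping, and trying a vertex. -/

theorem exec_popLoop {inp : List ℕ} {s : St} (hs : s.Bdd n) {t : ℕ}
    (ht : t = 0 ∨ s.F (t - 1) = 2) {i : ℕ} (hti : t ≤ i) (hi : i ≤ n)
    (hF : ∀ k, t ≤ k → k < i → s.F k ≠ 2) :
    Exec inp (n * n + n + 10) (.loop (.sub (.add (.sub (.const 1)
      (.sub (.reg (.add (.const 7) (.sub (varE 0) (.const 1)))) (.const 1)))
      (.sub (.const 1) (.sub (.const 1) (varE 0)))) (.const 1))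
      (.store (.const 0) (.sub (varE 0) (.const 1))))
      (St.mem {s with j := i}) (St.mem {s with j := t}) (2 * (i - t) + 1) := by
  have hb : ∀ i ≤ n, St.Bdd n {s with j := i} := fun i hi => { hs with j := hi }
  induction h : i - t generalizing i with
  | zero =>
    obtain rfl : i = t := by omega
    refine Exec.loop_end (hb i hi).fits ?_
    -- At `i = 0` truncated subtraction makes the guard read entry 0, but then its second conjunct
    -- is 0.
    simp only [Expr.eval, St.mem_zero, St.mem_add]
    omega
  | succ k ih =>
    obtain ⟨l, rfl⟩ : ∃ l, i = l + 1 := ⟨i - 1, by omega⟩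
    refine (Exec.loop_step (hb _ hi).fits ?_ (Exec.store (hb _ hi).fits ?_)
      (ih (i := l) (by omega) (by omega) (fun k h1 h2 => hF k h1 (by omega)) (by omega))).mono
        (by omega)
    · have h1 := hF l (by omega) (by omega)
      have h2 := hs.F l
      simp only [Expr.eval, St.mem_zero, St.mem_add, Nat.add_sub_cancel]
      omega
    · simp only [Expr.eval, St.mem_zero, St.update_zero, Nat.add_sub_cancel]

/-- The states in which the main loop starts. -/
structure St.Head (A : Finset (Fin n)) (i : ℕ) (s : St) : Prop where
  bdd : s.Bdd n
  j : s.j = i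
  done : s.done = 0
  marks : s.Marks A

theorem Silent.loop_true {inp : List ℕ} {m : ℕ} {e : Expr} {P : Program} {K : List Program}
    {σ : Memory} (h : Fits m σ) (he : e.eval inp σ ≠ 0) :
    Silent inp m ⟨.loop e P :: K, σ⟩ 1 ⟨P :: .loop e P :: K, σ⟩ := by
  refine .head (by simp) h rfl ?_
  simpa [step, he] using Silent.refl _

theorem Silent.cond_true {inp : List ℕ} {m : ℕ} {e : Expr} {P Q : Program} {K : List Program}
    {σ : Memory} (h : Fits m σ) (he : e.eval inp σ ≠ 0) :
    Silent inp m ⟨.cond e P Q :: K, σ⟩ 1 ⟨P :: K, σ⟩ := by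
  refine .head (by simp) h rfl ?_
  simpa [step, he] using Silent.refl _

theorem Silent.cond_false {inp : List ℕ} {m : ℕ} {e : Expr} {P Q : Program} {K : List Program}
    {σ : Memory} (h : Fits m σ) (he : e.eval inp σ = 0) :
    Silent inp m ⟨.cond e P Q :: K, σ⟩ 1 ⟨Q :: K, σ⟩ := by
  refine .head (by simp) h rfl ?_
  simpa [step, he] using Silent.refl _

theorem Silent.seq {inp : List ℕ} {m : ℕ} {P Q : Program} {K : List Program}
    {σ : Memory} (h : Fits m σ) : Silent inp m ⟨.seq P Q :: K, σ⟩ 1 ⟨P :: Q :: K, σ⟩ :=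
  .head (by simp) h rfl (.refl _)

/-- A bound for the duration of one round of the main loop. -/
def roundTime (n : ℕ) : ℕ := 10 * (n + 3) ^ 2

/-- All members of `A` lie below `w`, so the downward scan from `n` finds `w` first and stops at `j
= w + 1`, which is where the search of `A` has to resume. -/
theorem exec_pop {A A' : Finset (Fin n)} {w : Fin n} (hA : ∀ v ∈ A, v < w)
    (hA' : A' = insert w A) {s : St} (hs : s.Head A' n) :
    ∃ s' : St, s'.Head A (w + 1) ∧ ∃ k ≤ roundTime n,
      Silent (graphWord G) (n * n + n + 10) ⟨[mainLoop], s.mem⟩ k ⟨[mainLoop], s'.mem⟩ := by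
  subst hA'
  have hwA : w ∉ A := fun h => lt_irrefl _ (hA w h)
  have hb := hs.bdd
  have hb1 : St.Bdd n {s with j := w + 1} := { hb with j := w.2 }
  have hsj : s = {s with j := n} := by have := hs.j; cases s; cases this; rfl
  have hloop := exec_popLoop (inp := graphWord G) hb (t := w + 1) (i := n)
    (Or.inr ((hs.marks w).2 (mem_insert_self _ _))) w.2 le_rfl (fun k h1 h2 h3 => by
      have := (hs.marks ⟨k, h2⟩).1 h3
      rcases mem_insert.1 this with h | h
      · have := congrArg Fin.val h
        simp only at this
        omega
      · have := hA _ h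
        rw [Fin.lt_def] at this
        simp only at this
        omega)
  rw [← hsj] at hloop
  have hw := w.2
  have hbody : Exec (graphWord G) (n * n + n + 10) popProgram s.mem
      (St.mem {s with j := w + 1, F := Function.update s.F w 0}) (2 * n + 4) := by
    refine (Exec.seq hb.fits hloop (Exec.cond_true hb1.fits ?_
      (Exec.store hb1.fits ?_))).mono (by omega)
    · simp only [Expr.eval, St.mem_zero]
      omega
    · simp only [Expr.eval, St.mem_zero, Nat.add_sub_cancel, St.update_add]
  obtain ⟨k, hk, hbody⟩ := hbody
  refine ⟨{s with j := w + 1, F := Function.update s.F w 0}, ⟨⟨w.2, hb.done, hb.p, hb.q, hb.acc,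
    hb.row, hb.bad, fun i => ?_, fun i hi => ?_⟩, rfl, hs.done, fun v => ?_⟩, 1 + (1 + k), ?_,
    (Silent.loop_true hb.fits ?_).trans ((Silent.cond_false hb.fits ?_).trans (hbody _))⟩
  · show Function.update s.F w 0 i ≤ 2
    rw [Function.update_apply]
    split_ifs
    · omega
    · exact hb.F i
  · show Function.update s.F w 0 i = 0
    rw [Function.update_of_ne (by omega)]
    exact hb.F_of_le i hi
  · show Function.update s.F w 0 v = 2 ↔ _
    rw [Function.update_apply]
    split_ifs with h
    · obtain rfl : v = w := Fin.ext h
      simp [hwA]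
    · rw [hs.marks v, mem_insert]
      have : v ≠ w := fun h' => h (by rw [h'])
      simp [this]
  · unfold roundTime; nlinarith
  · simp only [Expr.eval, St.mem_one, hs.done]; omega
  · simp only [Expr.eval, St.mem_zero, hs.j, graphWord_zero]; omega

theorem exec_end {s : St} (hs : s.Head (∅ : Finset (Fin n)) n) :
    ∃ σ, Fits (n * n + n + 10) σ ∧ ∃ k ≤ roundTime n,
      Silent (graphWord G) (n * n + n + 10) ⟨[mainLoop], s.mem⟩ k ⟨[], σ⟩ := by
  have hb := hs.bdd
  have hb1 : St.Bdd n {s with j := 0} := { hb with j := Nat.zero_le _ }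
  have hb2 : St.Bdd n {s with j := 0, done := 1} := { hb1 with done := le_rfl }
  have hsj : s = {s with j := n} := by have := hs.j; cases s; cases this; rfl
  have hloop := exec_popLoop (inp := graphWord G) hb (t := 0) (i := n)
    (Or.inl rfl) (Nat.zero_le _) le_rfl (fun k h1 h2 h3 => by
      simpa using (hs.marks ⟨k, h2⟩).1 h3)
  rw [← hsj] at hloop
  have hbody : Exec (graphWord G) (n * n + n + 10) popProgram s.mem
      (St.mem {s with j := 0, done := 1}) (2 * n + 4) := by
    refine (Exec.seq hb.fits hloop (Exec.cond_false hb1.fits ?_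
      (Exec.store hb1.fits ?_))).mono (by omega)
    · simp only [Expr.eval, St.mem_zero]
    · simp only [Expr.eval, St.update_one]
  obtain ⟨k, hk, hbody⟩ := hbody
  obtain ⟨l, hl, hend⟩ := Exec.loop_end (inp := graphWord G) (e := .sub (.const 1) (varE 1))
    (P := .cond (.sub ordE (varE 0)) tryProgram popProgram) hb2.fits rfl
  refine ⟨_, hb2.fits, 1 + (1 + (k + l)), ?_, (Silent.loop_true hb.fits ?_).trans
    ((Silent.cond_false hb.fits ?_).trans ((hbody _).trans (hend [])))⟩
  · unfold roundTime; nlinarith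
  · simp only [Expr.eval, St.mem_one, hs.done]; omega
  · simp only [Expr.eval, St.mem_zero, hs.j, graphWord_zero]; omega

/-- The part of a round of the main loop in which a vertex is added and the outcome is tested. -/
theorem exec_try {A : Finset (Fin n)} {w : Fin n} {s : St} (hs : s.Head A w) :
    ∃ s' : St, (s'.Bdd n ∧ s'.j = w ∧ s'.done = 0 ∧ s'.Roman G (insert w A) ∧
      (s'.bad = 0 ↔ HasPrivate G univ (insert w A))) ∧ ∃ k, k + 10 ≤ roundTime n ∧
      Silent (graphWord G) (n * n + n + 10) ⟨[mainLoop], s.mem⟩ k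
        ⟨[.cond (varE 6) (.store (adrE 0) (.const 0)) (.output (.const 7) ordE),
          .store (.const 0) (.add (varE 0) (.const 1)), mainLoop], s'.mem⟩ := by
  have hb := hs.bdd
  have hw := w.2
  have hb1 : St.Bdd n {s with F := Function.update s.F w 2} := by
    refine ⟨hb.j, hb.done, hb.p, hb.q, hb.acc, hb.row, hb.bad, fun i => ?_, fun i hi => ?_⟩
    · show Function.update s.F w 2 i ≤ 2
      rw [Function.update_apply]
      split_ifs
      · omega
      · exact hb.F i
    · show Function.update s.F w 2 i = 0
      rw [Function.update_of_ne (by omega)]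
      exact hb.F_of_le i hi
  have hm1 : St.Marks (insert w A) {s with F := Function.update s.F w 2} := fun v => by
    show Function.update s.F w 2 v = 2 ↔ _
    rw [Function.update_apply]
    split_ifs with h
    · obtain rfl : v = w := Fin.ext h
      simp
    · rw [hs.marks v, mem_insert]
      have : v ≠ w := fun h' => h (by rw [h'])
      simp [this]
  obtain ⟨s2, ⟨hb2, hj2, hd2, hr2⟩, k2, hk2, h2⟩ := exec_fillProgram G _ _ hb1 hm1
  obtain ⟨s3, ⟨hb3, hj3, hd3, hr3, ht3⟩, k3, hk3, h3⟩ := exec_testProgram G _ _ hb2 hr2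
  obtain ⟨k1, hk1, h1⟩ := Exec.store (inp := graphWord G) (a := adrE 0) (e := .const 2) hb.fits
    (σ' := St.mem {s with F := Function.update s.F w 2}) (by
      simp only [Expr.eval, St.mem_zero, hs.j, St.update_add])
  refine ⟨s3, ⟨hb3, hj3.trans (hj2.trans hs.j), hd3.trans (hd2.trans hs.done), hr3, ht3⟩, _, ?_,
    (Silent.loop_true hb.fits ?_).trans ((Silent.cond_true hb.fits ?_).trans
      ((Silent.seq hb.fits).trans ((h1 _).trans ((Silent.seq hb1.fits).trans ((h2 _).trans
        ((Silent.seq hb2.fits).trans ((h3 _).trans (Silent.seq hb3.fits))))))))⟩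
  · unfold roundTime; nlinarith
  · simp only [Expr.eval, St.mem_one, hs.done]; omega
  · simp only [Expr.eval, St.mem_zero, hs.j, graphWord_zero]; omega

/-- Only the entry 2 of `w` is taken back. The zeros and ones computed for the rejected set remain,
which `Head` permits. -/
theorem exec_try_fail {A : Finset (Fin n)} {w : Fin n} (hwA : w ∉ A) {s : St} (hs : s.Head A w)
    (h : ¬ HasPrivate G univ (insert w A)) :
    ∃ s' : St, s'.Head A (w + 1) ∧ ∃ k ≤ roundTime n,
      Silent (graphWord G) (n * n + n + 10) ⟨[mainLoop], s.mem⟩ k ⟨[mainLoop], s'.mem⟩ := by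
  obtain ⟨s1, ⟨hb1, hj1, hd1, hr1, ht1⟩, k1, hk1, h1⟩ := exec_try G hs
  have hw := w.2
  have hb2 : St.Bdd n {s1 with F := Function.update s1.F w 0} := by
    refine ⟨hb1.j, hb1.done, hb1.p, hb1.q, hb1.acc, hb1.row, hb1.bad, fun i => ?_,
      fun i hi => ?_⟩
    · show Function.update s1.F w 0 i ≤ 2
      rw [Function.update_apply]
      split_ifs
      · omega
      · exact hb1.F i
    · show Function.update s1.F w 0 i = 0
      rw [Function.update_of_ne (by omega)]
      exact hb1.F_of_le i hi
  obtain ⟨k2, hk2, h2⟩ := Exec.store (inp := graphWord G) (a := adrE 0) (e := .const 0) hb1.fits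
    (σ' := St.mem {s1 with F := Function.update s1.F w 0}) (by
      simp only [Expr.eval, St.mem_zero, hj1, St.update_add])
  obtain ⟨k3, hk3, h3⟩ := Exec.store (inp := graphWord G) (a := .const 0)
    (e := .add (varE 0) (.const 1)) hb2.fits
    (σ' := St.mem {s1 with F := Function.update s1.F w 0, j := w + 1}) (by
      simp only [Expr.eval, St.mem_zero, hj1, St.update_zero])
  refine ⟨{s1 with F := Function.update s1.F w 0, j := w + 1}, ⟨{ hb2 with j := hw }, rfl, hd1,
    fun v => ?_⟩, _, ?_, h1.trans ((Silent.cond_true hb1.fits ?_).trans ((h2 _).trans (h3 _)))⟩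
  · show Function.update s1.F w 0 v = 2 ↔ _
    rw [Function.update_apply]
    split_ifs with h
    · obtain rfl : v = w := Fin.ext h
      simp [hwA]
    · rw [hr1.marks v, mem_insert]
      have : v ≠ w := fun h' => h (by rw [h'])
      simp [this]
  · omega
  · simp only [Expr.eval, St.mem_six]
    exact fun h0 => h (ht1.1 h0)

theorem St.Roman.word {A : Finset (Fin n)} {s : St} (h : s.Roman G A) :
    ((List.range n).map fun i => s.mem (7 + i)) = wordOf G A := by
  refine List.ext_getElem (by simp [wordOf, functionWord]) fun i h1 h2 => ?_
  have hi : i < n := by simpa using h1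
  simp only [List.getElem_map, List.getElem_range, St.mem_add, wordOf, functionWord,
    List.getElem_ofFn]
  exact h ⟨i, hi⟩

theorem reach_try {A : Finset (Fin n)} {w : Fin n} {s : St} (hs : s.Head A w)
    (h : HasPrivate G univ (insert w A)) {d t l : ℕ} (o : List (List ℕ))
    (ht : t + roundTime n ≤ l + d) :
    ∃ s' : St, s'.Head (insert w A) (w + 1) ∧ ∃ t' l', t' ≤ t + roundTime n ∧
      t' ≤ l' + roundTime n ∧ Reach (graphWord G) (n * n + n + 10) d ⟨⟨[mainLoop], s.mem⟩, t, l, o⟩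
        ⟨⟨[mainLoop], s'.mem⟩, t', l', o ++ [wordOf G (insert w A)]⟩ := by
  obtain ⟨s1, ⟨hb1, hj1, hd1, hr1, ht1⟩, k1, hk1, h1⟩ := exec_try G hs
  obtain ⟨k3, hk3, h3⟩ := Exec.store (inp := graphWord G) (a := .const 0)
    (e := .add (varE 0) (.const 1)) hb1.fits (σ' := St.mem {s1 with j := w + 1}) (by
      simp only [Expr.eval, St.mem_zero, hj1, St.update_zero])
  have h2 := (h1.trans (Silent.cond_false hb1.fits (by
    simp only [Expr.eval, St.mem_six]
    exact ht1.2 h))).reach (d := d) t l o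
  have h4 := h2.trans (Reach.output hb1.fits (by omega))
  have h5 := h4.trans ((h3 _).reach _ _ _)
  simp only [Expr.eval, graphWord_zero, hr1.word] at h5
  exact ⟨{s1 with j := w + 1}, ⟨{ hb1 with j := w.2 }, rfl, hd1, hr1.marks⟩, _, _, by omega,
    by omega, h5⟩

end Graph

end RAM

/-! ### Total time and delay of the search. -/

namespace RAM

open PrivateNeighbors Finset

section Graph

variable {n : ℕ} (G : SimpleGraph (Fin n)) [DecidableRel G.Adj]

/-- Time is budgeted in rounds. In the worst case no further output comes: `n - i` trials remain on
this level, each of the `#A` levels above costs one removal and at most `n` trials, and one round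
ends the run. The hypothesis `ht` grants this slack, and on return the part for this level may have
been spent. For the total time, each listed set pays for its removal and for the trials on its own
level. -/
theorem reach_search {d : ℕ} (hd : roundTime n * ((n + 1) ^ 2 + 2) ≤ d) {A : Finset (Fin n)}
    {i : ℕ} (hA : ∀ v ∈ A, (v : ℕ) < i) (hi : i ≤ n) {s : St} (hs : s.Head A i) {t l : ℕ}
    (o : List (List ℕ)) (ht : t + roundTime n * (#A * (n + 1) + (n - i) + 1) ≤ l + d) :
    ∃ s' : St, s'.Head A n ∧ ∃ t' l',
      t' ≤ t + roundTime n * (n - i + (n + 1) * (search G A i).length) ∧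
      t' + roundTime n * (#A * (n + 1) + 1) ≤ l' + d ∧
      Reach (graphWord G) (n * n + n + 10) d ⟨⟨[mainLoop], s.mem⟩, t, l, o⟩
        ⟨⟨[mainLoop], s'.mem⟩, t', l', o ++ (search G A i).map (wordOf G)⟩ := by
  induction h : n - i generalizing A i s t l o with
  | zero =>
    obtain rfl : i = n := by omega
    rw [search_of_le G A le_rfl]
    refine ⟨s, hs, t, l, by simp, ?_, by simpa using Reach.refl _⟩
    simpa using ht
  | succ k ih =>
    have hin : i < n := by omega
    have hwA : (⟨i, hin⟩ : Fin n) ∉ A := fun h => lt_irrefl _ (hA _ h)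
    have hA1 : ∀ v ∈ insert ⟨i, hin⟩ A, (v : ℕ) < i + 1 := fun v hv => by
      rcases mem_insert.1 hv with rfl | hv
      · exact Nat.lt_succ_self _
      · exact (hA v hv).trans (Nat.lt_succ_self _)
    have hA2 : ∀ v ∈ A, (v : ℕ) < i + 1 := fun v hv => (hA v hv).trans (Nat.lt_succ_self _)
    have hk : n - (i + 1) = k := by omega
    have hkn : k + 1 ≤ n := by omega
    rw [search, dif_pos hin]
    rw [h] at ht
    split_ifs with hv
    · have hcard : #(insert ⟨i, hin⟩ A) = #A + 1 := card_insert_of_notMem hwA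
      have hcn : #A + 1 ≤ n := hcard ▸ (card_le_univ _).trans (by simp)
      obtain ⟨s1, hs1, t1, l1, ht1, htl1, hr1⟩ := reach_try G (w := ⟨i, hin⟩) hs hv o
        (d := d) (t := t) (l := l) (by
          have := Nat.le_mul_of_pos_right (roundTime n)
            (Nat.succ_pos (#A * (n + 1) + (k + 1)))
          rw [Nat.succ_eq_add_one] at this
          omega)
      obtain ⟨s2, hs2, t2, l2, ht2, htl2, hr2⟩ := ih hA1 hin hs1
        (o ++ [wordOf G (insert ⟨i, hin⟩ A)]) (t := t1) (l := l1) (by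
          rw [hk]
          -- The new output resets the clock up to one round, so the full delay `d` is available
          -- again; `#A + 1 ≤ n` keeps the worst case within it.
          have : #(insert ⟨i, hin⟩ A) * (n + 1) + k + 1 + 1 ≤ (n + 1) ^ 2 + 2 := by
            rw [hcard]; nlinarith
          have := (Nat.mul_le_mul_left (roundTime n) this).trans hd
          rw [Nat.mul_add_one] at this
          omega) hk
      obtain ⟨s3, hs3, k3, hk3, h3⟩ := exec_pop G (w := ⟨i, hin⟩) (A := A)
        (fun v hv => Fin.lt_def.2 (hA v hv)) rfl hs2
      rw [hcard] at htl2
      obtain ⟨s4, hs4, t4, l4, ht4, htl4, hr4⟩ := ih hA2 hin hs3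
        (o ++ [wordOf G (insert ⟨i, hin⟩ A)] ++
          (search G (insert ⟨i, hin⟩ A) (i + 1)).map (wordOf G)) (t := t2 + k3) (l := l2) (by
            rw [hk]
            -- The larger set left slack for one more level, which pays for its removal and for the
            -- `k` trials that remain here.
            have : 1 + (#A * (n + 1) + k + 1) ≤ (#A + 1) * (n + 1) + 1 := by nlinarith
            have := Nat.mul_le_mul_left (roundTime n) this
            rw [Nat.mul_add _ 1, Nat.mul_one] at this
            omega) hk
      refine ⟨s4, hs4, t4, l4, ?_, htl4, ?_⟩
      · simp only [List.length_append, List.length_cons]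
        generalize (search G (insert ⟨i, hin⟩ A) (i + 1)).length = a at ht2
        generalize (search G A (i + 1)).length = b at ht4
        have : 1 + (k + (n + 1) * a) + 1 + (k + (n + 1) * b) ≤
            k + 1 + (n + 1) * (a + 1 + b) := by nlinarith
        have := Nat.mul_le_mul_left (roundTime n) this
        simp only [Nat.mul_add, Nat.mul_one] at this ht2 ht4 ⊢
        omega
      · have := hr1.trans (hr2.trans ((h3.reach _ _ _).trans hr4))
        simpa using this
    · obtain ⟨s1, hs1, k1, hk1, h1⟩ := exec_try_fail G hwA hs hv
      obtain ⟨s4, hs4, t4, l4, ht4, htl4, hr4⟩ := ih hA2 hin hs1 o (t := t + k1) (l := l) (by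
        rw [hk]
        nlinarith) hk
      refine ⟨s4, hs4, t4, l4, ?_, htl4, ?_⟩
      · simp only [List.nil_append]
        simp only [Nat.mul_add, Nat.mul_one] at ht4 ⊢
        omega
      · have := (h1.reach _ _ _).trans hr4
        simpa using this

theorem enumProgram_enumerates : ∃ T ≤ roundTime n * (n + 3) * ((search G ∅ 0).length + 1),
    Enumerates enumProgram (graphWord G)
      {w | ∃ f : Fin n → Fin 3, IsMinimalPerfectRomanDominating G f ∧ w = functionWord f}
      T (roundTime n * ((n + 1) ^ 2 + 2)) (n * n + n + 10) := by
  set d := roundTime n * ((n + 1) ^ 2 + 2) with hd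
  let s0 : St := ⟨0, 0, 0, 0, 0, 0, 0, fun _ => 0⟩
  have hs0 : s0.Bdd n := ⟨Nat.zero_le _, Nat.zero_le _, Nat.zero_le _, Nat.zero_le _,
    Nat.zero_le _, Nat.zero_le _, Nat.zero_le _, fun _ => Nat.zero_le _, fun _ _ => rfl⟩
  have hmem : s0.mem = fun _ => 0 := by
    funext i
    rcases i with _ | _ | _ | _ | _ | _ | _ | i <;> rfl
  -- The root of the tree, the empty set, is filled in and output before the loop starts.
  obtain ⟨s1, ⟨hb1, hj1, hd1, hr1⟩, k1, hk1, h1⟩ := exec_fillProgram G ∅ s0 hs0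
    (fun v => by simp [s0])
  have hk1' : k1 + 3 ≤ roundTime n := by unfold roundTime; nlinarith
  have hstart := ((Silent.seq hs0.fits).trans ((h1 _).trans (Silent.seq (K := [])
    (P := .output (.const 7) ordE) (Q := mainLoop) hb1.fits))).reach (d := d) 0 0 []
  have hstart := hstart.trans (Reach.output hb1.fits (by
    rw [hd]
    have : 1 ≤ (n + 1) ^ 2 + 2 := by omega
    nlinarith))
  simp only [Expr.eval, graphWord_zero, hr1.word] at hstart
  obtain ⟨s2, hs2, t2, l2, ht2, htl2, h2⟩ := reach_search G (A := ∅) hd.ge (i := 0) (by simp)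
    (Nat.zero_le _) ⟨hb1, hj1, hd1, hr1.marks⟩ ([] ++ [wordOf G ∅])
    (t := 0 + (1 + (k1 + 1)) + 1) (l := 0 + (1 + (k1 + 1)) + 1) (by
      have : #(∅ : Finset (Fin n)) * (n + 1) + (n - 0) + 1 ≤ (n + 1) ^ 2 + 2 := by
        rw [card_empty, Nat.sub_zero]; nlinarith
      have := Nat.mul_le_mul_left (roundTime n) this
      omega)
  obtain ⟨σ, hσ, k3, hk3, h3⟩ := exec_end G hs2
  have hreach := hstart.trans (h2.trans (h3.reach _ _ _))
  rw [hmem] at hreach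
  refine ⟨t2 + k3, ?_, hreach.enumerates hσ ?_ ?_ ?_⟩
  · generalize (search G ∅ 0).length = a at ht2
    have : 1 + (n - 0 + (n + 1) * a) + 1 ≤ (n + 3) * (a + 1) := by
      rw [Nat.sub_zero]; nlinarith
    have := Nat.mul_le_mul_left (roundTime n) this
    rw [← Nat.mul_assoc] at this
    simp only [Nat.mul_add, Nat.mul_one] at this ht2 ⊢
    omega
  · simp only [card_empty, Nat.zero_mul, Nat.zero_add, Nat.mul_one] at htl2
    omega
  · have := (nodup_cons_search G).map (wordOf_injective G)
    simpa using this
  · intro w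
    rw [Set.mem_ofPred_eq, ← mem_words_iff G w]
    simp

end Graph

end RAM

open Polynomial in
theorem mainTheorem2 :
    ∃ (P : RAM.Program) (time delay space : Polynomial ℕ),
      ∀ (n : ℕ) (G : SimpleGraph (Fin n)) [DecidableRel G.Adj],
        ∃ T : ℕ, (T : ℝ) ≤ ((time.eval n : ℕ) : ℝ) * (1.9332 : ℝ) ^ n ∧
          RAM.Enumerates P (graphWord G)
            {w | ∃ f : Fin n → Fin 3, IsMinimalPerfectRomanDominating G f ∧ w = functionWord f}
            T (delay.eval n) (space.eval n) := by
  refine ⟨RAM.enumProgram, 10 * (X + 3) ^ 2 * (X + 3), 10 * (X + 3) ^ 2 * ((X + 1) ^ 2 + 2),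
    X * X + X + 10, fun n G _ => ?_⟩
  obtain ⟨T, hT, h⟩ := RAM.enumProgram_enumerates G
  have e1 : (10 * (X + 3) ^ 2 * (X + 3) : ℕ[X]).eval n = RAM.roundTime n * (n + 3) := by
    simp [RAM.roundTime]
  have e2 : (10 * (X + 3) ^ 2 * ((X + 1) ^ 2 + 2) : ℕ[X]).eval n =
      RAM.roundTime n * ((n + 1) ^ 2 + 2) := by
    simp [RAM.roundTime]
  have e3 : (X * X + X + 10 : ℕ[X]).eval n = n * n + n + 10 := by simp
  refine ⟨T, ?_, by rw [e2, e3]; exact h⟩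
  rw [e1]
  have h1 := PrivateNeighbors.length_search_le G
  have h2 : (T : ℝ) ≤ (RAM.roundTime n * (n + 3) : ℕ) *
      ((PrivateNeighbors.search G ∅ 0).length + 1) := by exact_mod_cast hT
  exact h2.trans (mul_le_mul_of_nonneg_left h1 (Nat.cast_nonneg _))
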